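/- Let $\Omega\subset\mathbb{R}^2$ be a polygonal domain with a finite conforming triangular mesh $\mathcal{T}_h$, so that $\Omega$ is the interior of the union of the closed triangles $K\in\mathcal{T}_h$. For $K\in\mathcal{T}_h$ let $K_0$ be its interior, $\partial K$ its boundary, $\mathbf{n}$ the unit outward normal on $\partial K$, $|K|$ its area and $h_K$ its diameter; write $(\cdot,\cdot)_K$ for the $L^2(K)$ inner product, $(\cdot,\cdot)=\sum_K(\cdot,\cdot)_K$ and $\langle\cdot,\cdot\rangle_{\partial K}$ for the $L^2(\partial K)$ inner product. An edge is called a boundary edge if it lies on $\partial\Omega$. Let $\mathcal{A}(\mathbf{x})\in\mathbb{R}^{2\times2}$ be symmetric and uniformly positive definite for $\mathbf{x}\in\Omega$ and, for every $K$, Lipschitz continuous in the interior of $K$ with constant $L_{\mathcal{A},K}$: $$|\mathcal{A}(\mathbf{x})-\mathcal{A}(\mathbf{y})|\le L_{\mathcal{A},K}\,|\mathbf{x}-\mathbf{y}|\qquad\text{for all }\mathbf{x},\mathbf{y}\in K_0,$$ where $|\cdot|$ is the Euclidean norm on vectors and the matrix norm induced by it (so $\mathcal{A}$ may jump across edges).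 Put $$\lambda_{\min,K}(\mathcal{A})=\inf_{\mathbf{x}\in K_0}\lambda_{\min}(\mathcal{A}(\mathbf{x})),\qquad \mathcal{A}_K=\frac1{|K|}\int_K\mathcal{A}\,d\mathbf{x},$$ with $\lambda_{\min}$ the smallest eigenvalue. For a vertex $p$ of $K$ with the other two vertices $q,r$, let $\alpha_{p,\mathcal{A}_K^{-1}}$ denote the angle of $K$ at $p$ measured in the metric $\mathcal{A}_K^{-1}$, i.e. $$\cos\alpha_{p,\mathcal{A}_K^{-1}}=\frac{(q-p)^T\mathcal{A}_K^{-1}(r-p)}{\sqrt{(q-p)^T\mathcal{A}_K^{-1}(q-p)}\,\sqrt{(r-p)^T\mathcal{A}_K^{-1}(r-p)}}.$$ Let $V_h$ be the space of functions $v=\{v_0,v_b\}$ that consist of one constant $v_0|_{K_0}$ for the interior of each triangle $K$ and one constant $v_b|_e$ for each edge $e$. Let $RT_0(K)=\{\mathbf{a}+c\,\mathbf{x}:\mathbf{a}\in\mathbb{R}^2,\ c\in\mathbb{R}\}$. The weak gradient $\nabla_w v$ of $v\in V_h$ is defined on each $K$ by $\nabla_w v|_K\in RT_0(K)$ and $$(\nabla_w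 v,\mathbf{q})_K=-(v_0,\nabla\cdot\mathbf{q})_K+\langle v_b,\mathbf{q}\cdot\mathbf{n}\rangle_{\partial K}\qquad\text{for all }\mathbf{q}\in RT_0(K).$$ Given $f\in L^1(\Omega)$ and constants $g_h|_e$ on the boundary edges $e$, a weak Galerkin approximation is a function $u_h=\{u_0,u_b\}\in V_h$ with $u_b=g_h$ on the boundary edges and $$(\mathcal{A}\nabla_w u_h,\nabla_w v)=(f,v_0)\qquad\text{for all }v=\{v_0,v_b\}\in V_h\text{ with }v_b=0\text{ on the boundary edges}.$$ **Theorem.** Suppose that for every $K\in\mathcal{T}_h$ $$\frac{L_{\mathcal{A},K}^2h_K^2}{\lambda_{\min,K}(\mathcal{A})^2}\le\cos\alpha_{p,\mathcal{A}_K^{-1}}\quad\text{for each of the three vertices }p\text{ of }K,\qquad\text{and}\qquad \frac{h_K^3}{|K|}\le\frac{2\lambda_{\min,K}(\mathcal{A})}{3L_{\mathcal{A},K}},$$ where the last condition is void if $L_{\mathcal{A},K}=0$. Then every weak Galerkin approximation $u_h$ satisfies the discrete maximum principle: if $f(\mathbf{x})\le0$ for all $\mathbf{x}\in\Omega$, then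 $$u_h(\mathbf{x})\le\max\Bigl\{0,\ \max_{e\text{ boundary edge}}u_b|_e\Bigr\}\qquad\text{for all }\mathbf{x}\in\Omega\text{ that are not vertices of the mesh}.$$ -/

import Mathlib

open MeasureTheory Set
open scoped Matrix.Norms.L2Operator

noncomputable section

namespace WeakGalerkin

/-- The Euclidean plane. -/
abbrev Plane : Type := EuclideanSpace ℝ (Fin 2)

/-- The bilinear form `(u, v) ↦ uᵀ B v` of a `2 × 2` matrix. -/
def matForm (B : Matrix (Fin 2) (Fin 2) ℝ) (u v : Plane) : ℝ :=
  u.ofLp ⬝ᵥ (B.mulVec v.ofLp)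

/-- A (conforming) triangular mesh of the open set `Ω`: a finite simplicial complex in the plane, each
face of which lies in a triangle, and such that `Ω` is the interior of the union of the closed
triangles. A face is stored as the finite set of its vertices. -/
structure TriangularMesh (Ω : Set Plane) where
  complex : Geometry.SimplicialComplex ℝ Plane
  finite_faces : complex.faces.Finite
  pure : ∀ s ∈ complex.faces, ∃ K ∈ complex.faces, K.card = 3 ∧ s ⊆ K
  domain_eq : Ω = interior complex.space

variable {Ω : Set Plane}

namespace TriangularMesh

/-- The elements (triangles) of the mesh. -/
def Element (T : TriangularMesh Ω) : Type :=
  {s : Finset Plane // s ∈ T.complex.faces ∧ s.card = 3}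

/-- The edges of the mesh. -/
def Edge (T : TriangularMesh Ω) : Type :=
  {s : Finset Plane // s ∈ T.complex.faces ∧ s.card = 2}

instance (T : TriangularMesh Ω) : Fintype T.Element :=
  (T.finite_faces.subset (fun _ hs => hs.1 :
    {s : Finset Plane | s ∈ T.complex.faces ∧ s.card = 3} ⊆ T.complex.faces)).fintype

instance (T : TriangularMesh Ω) : Fintype T.Edge :=
  (T.finite_faces.subset (fun _ hs => hs.1 :
    {s : Finset Plane | s ∈ T.complex.faces ∧ s.card = 2} ⊆ T.complex.faces)).fintype

variable {T : TriangularMesh Ω}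

/-- The closed triangle. -/
def Element.closedCell (K : T.Element) : Set Plane := convexHull ℝ (K.1 : Set Plane)

/-- The interior `K₀` of the triangle `K`. -/
def Element.cell (K : T.Element) : Set Plane := interior K.closedCell

/-- The area `|K|`. -/
def Element.area (K : T.Element) : ℝ := volume.real K.cell

/-- The diameter `h_K`. -/
def Element.diam (K : T.Element) : ℝ := Metric.diam K.closedCell

/-- The closed segment. -/
def Edge.closedCell (e : T.Edge) : Set Plane := convexHull ℝ (e.1 : Set Plane)

/-- The segment without its two end points. -/
def Edge.cell (e : T.Edge) : Set Plane := e.closedCell \ (e.1 : Set Plane)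

/-- The boundary edges, that is, those that lie on `∂Ω`. -/
def Edge.IsBoundary (e : T.Edge) : Prop := e.closedCell ⊆ frontier Ω

open Classical in
/-- The edges of the element `K`. -/
def Element.edges (K : T.Element) : Finset T.Edge :=
  Finset.univ.filter fun e => e.1 ⊆ K.1

/-- The unit outward normal of the element `K` on its edge `e`: the normalized component orthogonal
to `e` of the vector from the centroid of `K` to the midpoint of `e`. -/
def outwardNormal (K : T.Element) (e : T.Edge) : Plane :=
  let d := (vectorSpan ℝ (e.1 : Set Plane))ᗮ.starProjection
    ((2 : ℝ)⁻¹ • ∑ x ∈ e.1, x - (3 : ℝ)⁻¹ • ∑ x ∈ K.1, x)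
  ‖d‖⁻¹ • d

end TriangularMesh

open TriangularMesh

/-- The lowest order Raviart-Thomas space: the vector fields `x ↦ a + c x` with `a ∈ ℝ²`, `c ∈ ℝ`
(as polynomial fields; they are used on one element at a time). -/
def RT0 : Submodule ℝ (Plane → Plane) where
  carrier := {q | ∃ (a : Plane) (c : ℝ), ∀ x, q x = a + c • x}
  add_mem' := by
    rintro p q ⟨a, c, h⟩ ⟨b, d, k⟩
    exact ⟨a + b, c + d, fun x => by rw [Pi.add_apply, h, k, add_smul]; abel⟩
  zero_mem' := ⟨0, 0, fun x => by simp⟩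
  smul_mem' := by
    rintro r q ⟨a, c, h⟩
    exact ⟨r • a, r * c, fun x => by rw [Pi.smul_apply, h, smul_add, smul_smul]⟩

/-- The divergence of a vector field. -/
def divergence (q : Plane → Plane) (x : Plane) : ℝ :=
  ∑ i : Fin 2, (fderiv ℝ q x (EuclideanSpace.single i 1)) i

/-- The weak discrete space `V_h`: one constant for the interior of each element and one constant for
each edge. -/
@[ext]
structure DiscreteFunction (T : TriangularMesh Ω) where
  elem : T.Element → ℝ
  edge : T.Edge → ℝ

/-- The value of a function of `V_h` at a point: the sum of the basis functions (the indicators of the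
open triangles and of the open edges) times their coefficients. No value is meant at the vertices of
the mesh. -/
def DiscreteFunction.toFun {T : TriangularMesh Ω} (u : DiscreteFunction T) (x : Plane) : ℝ :=
  ∑ K : T.Element, K.cell.indicator (fun _ => u.elem K) x +
    ∑ e : T.Edge, e.cell.indicator (fun _ => u.edge e) x

/-- `p` is the weak gradient of `v` on `K`: `p ∈ RT₀(K)` and
`(p, q)_K = -(v₀, ∇ ⬝ q)_K + ⟨v_b, q ⬝ n⟩_∂K` for all `q ∈ RT₀(K)`. The integral over `∂K` is taken
with respect to arc length (one-dimensional Hausdorff measure). -/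
def IsWeakGradient {T : TriangularMesh Ω} (v : DiscreteFunction T) (K : T.Element)
    (p : Plane → Plane) : Prop :=
  p ∈ RT0 ∧ ∀ q ∈ RT0, ∫ x in K.cell, inner ℝ (p x) (q x) =
    -(∫ x in K.cell, v.elem K * divergence q x) +
      ∑ e ∈ K.edges, ∫ x in e.closedCell,
        v.edge e * inner ℝ (q x) (outwardNormal K e) ∂(Measure.hausdorffMeasure 1 : Measure Plane)

section Existence

variable {T : TriangularMesh Ω}

lemma RT0.contDiff {q : Plane → Plane} (hq : q ∈ RT0) : ContDiff ℝ 1 q := by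
  obtain ⟨a, c, h⟩ := hq
  obtain rfl : q = fun x => a + c • x := funext h
  fun_prop

lemma divergence_add {p q : Plane → Plane} (hp : p ∈ RT0) (hq : q ∈ RT0) (x : Plane) :
    divergence (p + q) x = divergence p x + divergence q x := by
  have h1 := (RT0.contDiff hp).differentiable (by norm_num) x
  have h2 := (RT0.contDiff hq).differentiable (by norm_num) x
  simp only [divergence, fderiv_add h1 h2, ← Finset.sum_add_distrib]
  rfl

lemma divergence_smul (r : ℝ) {q : Plane → Plane} (hq : q ∈ RT0) (x : Plane) :
    divergence (r • q) x = r * divergence q x := by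
  have h2 := (RT0.contDiff hq).differentiable (by norm_num) x
  simp only [divergence, fderiv_const_smul h2, Finset.mul_sum]
  rfl

lemma continuous_divergence {q : Plane → Plane} (hq : q ∈ RT0) : Continuous (divergence q) := by
  have h := (RT0.contDiff hq).continuous_fderiv (by norm_num)
  unfold divergence
  fun_prop

lemma Element.isCompact (K : T.Element) : IsCompact K.closedCell :=
  K.1.finite_toSet.isCompact_convexHull ℝ

lemma Element.integrableOn (K : T.Element) {g : Plane → ℝ} (hg : Continuous g) :
    IntegrableOn g K.cell :=
  (hg.continuousOn.integrableOn_compact (Element.isCompact K)).mono_set interior_subset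

lemma Edge.integrableOn (e : T.Edge) {g : Plane → ℝ} (hg : Continuous g) :
    IntegrableOn g e.closedCell (Measure.hausdorffMeasure 1 : Measure Plane) := by
  have hc : IsCompact e.closedCell := e.1.finite_toSet.isCompact_convexHull ℝ
  obtain ⟨C, hC⟩ := hc.exists_bound_of_continuousOn hg.continuousOn
  refine Measure.integrableOn_of_bounded (M := C) ?_ hg.aestronglyMeasurable
    ((ae_restrict_iff' hc.measurableSet).2 (Filter.Eventually.of_forall hC))
  obtain ⟨a, b, -, hab⟩ := Finset.card_eq_two.1 e.2.2
  have : e.closedCell = segment ℝ a b := by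
    simp [Edge.closedCell, hab, convexHull_pair]
  rw [this, hausdorffMeasure_segment]
  exact edist_ne_top _ _

lemma Element.cell_nonempty (K : T.Element) : K.cell.Nonempty := by
  have hi := T.complex.indep K.2.1
  have h := (hi.affineSpan_eq_top_iff_card_eq_finrank_add_one).2 (by simp [K.2.2])
  rw [Subtype.range_coe_subtype] at h
  exact interior_convexHull_nonempty_iff_affineSpan_eq_top.2 h

instance : FiniteDimensional ℝ RT0 := by
  let Φ : (Plane × ℝ) →ₗ[ℝ] (Plane → Plane) :=
    { toFun := fun w x => w.1 + w.2 • x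
      map_add' := fun v w => by funext x; simp [add_smul]; abel
      map_smul' := fun r w => by funext x; simp [smul_smul] }
  have h : RT0 ≤ LinearMap.range Φ := by
    rintro q ⟨a, c, h⟩
    exact ⟨(a, c), (funext h).symm⟩
  exact Submodule.finiteDimensional_of_le h

/-- The weak gradient is well defined. -/
theorem existsUnique_isWeakGradient (v : DiscreteFunction T) (K : T.Element) :
    ∃! p, IsWeakGradient v K p := by
  have hcont : ∀ q : RT0, Continuous q.1 := fun q => (RT0.contDiff q.2).continuous
  have hint : ∀ p q : RT0, IntegrableOn (fun x => inner ℝ (p.1 x) (q.1 x)) K.cell := fun p q =>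
    Element.integrableOn K ((hcont p).inner (hcont q))
  have hdiv : ∀ q : RT0, IntegrableOn (fun x => v.elem K * divergence q.1 x) K.cell := fun q =>
    Element.integrableOn K (continuous_const.mul (continuous_divergence q.2))
  have hedge : ∀ (q : RT0) (e : T.Edge),
      IntegrableOn (fun x => v.edge e * inner ℝ (q.1 x) (outwardNormal K e)) e.closedCell
        (Measure.hausdorffMeasure 1 : Measure Plane) := fun q e =>
    Edge.integrableOn e (continuous_const.mul ((hcont q).inner continuous_const))
  let B : RT0 →ₗ[ℝ] Module.Dual ℝ RT0 := LinearMap.mk₂ ℝ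
    (fun p q => ∫ x in K.cell, inner ℝ (p.1 x) (q.1 x))
    (fun p p' q => by
      simp only [Submodule.coe_add, Pi.add_apply, inner_add_left]
      exact integral_add (hint p q) (hint p' q))
    (fun r p q => by
      simp only [Submodule.coe_smul, Pi.smul_apply, real_inner_smul_left, smul_eq_mul]
      exact integral_const_mul _ _)
    (fun p q q' => by
      simp only [Submodule.coe_add, Pi.add_apply, inner_add_right]
      exact integral_add (hint p q) (hint p q'))
    (fun r p q => by
      simp only [Submodule.coe_smul, Pi.smul_apply, real_inner_smul_right, smul_eq_mul]
      exact integral_const_mul _ _)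
  let F : Module.Dual ℝ RT0 :=
    { toFun := fun q => -(∫ x in K.cell, v.elem K * divergence q.1 x) +
        ∑ e ∈ K.edges, ∫ x in e.closedCell,
          v.edge e * inner ℝ (q.1 x) (outwardNormal K e)
            ∂(Measure.hausdorffMeasure 1 : Measure Plane)
      map_add' := fun p q => by
        have h1 : ∫ x in K.cell, v.elem K * divergence (p + q : RT0).1 x =
            (∫ x in K.cell, v.elem K * divergence p.1 x) +
              ∫ x in K.cell, v.elem K * divergence q.1 x := by
          rw [← integral_add (hdiv p) (hdiv q)]
          congr 1; funext x
          rw [Submodule.coe_add, divergence_add p.2 q.2, mul_add]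
        have h2 : ∀ e : T.Edge, ∫ x in e.closedCell,
            v.edge e * inner ℝ ((p + q : RT0).1 x) (outwardNormal K e)
              ∂(Measure.hausdorffMeasure 1 : Measure Plane) =
            (∫ x in e.closedCell, v.edge e * inner ℝ (p.1 x) (outwardNormal K e)
              ∂(Measure.hausdorffMeasure 1 : Measure Plane)) +
            ∫ x in e.closedCell, v.edge e * inner ℝ (q.1 x) (outwardNormal K e)
              ∂(Measure.hausdorffMeasure 1 : Measure Plane) := fun e => by
          rw [← integral_add (hedge p e) (hedge q e)]
          congr 1; funext x
          rw [Submodule.coe_add, Pi.add_apply, inner_add_left, mul_add]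
        simp only [h1, h2, Finset.sum_add_distrib]
        ring
      map_smul' := fun r q => by
        have h1 : ∫ x in K.cell, v.elem K * divergence (r • q : RT0).1 x =
            r * ∫ x in K.cell, v.elem K * divergence q.1 x := by
          rw [← integral_const_mul]
          congr 1; funext x
          rw [Submodule.coe_smul, divergence_smul r q.2]; ring
        have h2 : ∀ e : T.Edge, ∫ x in e.closedCell,
            v.edge e * inner ℝ ((r • q : RT0).1 x) (outwardNormal K e)
              ∂(Measure.hausdorffMeasure 1 : Measure Plane) =
            r * ∫ x in e.closedCell, v.edge e * inner ℝ (q.1 x) (outwardNormal K e)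
              ∂(Measure.hausdorffMeasure 1 : Measure Plane) := fun e => by
          rw [← integral_const_mul]
          congr 1; funext x
          rw [Submodule.coe_smul, Pi.smul_apply, real_inner_smul_left]; ring
        simp only [h1, h2, ← Finset.mul_sum, RingHom.id_apply, smul_eq_mul]
        ring }
  have hinj : Function.Injective B := by
    rw [injective_iff_map_eq_zero]
    intro p hp
    have h0 : ∫ x in K.cell, inner ℝ (p.1 x) (p.1 x) = 0 := by
      exact LinearMap.congr_fun hp p
    have hz := (setIntegral_eq_zero_iff_of_nonneg_ae
      (Filter.Eventually.of_forall fun x => real_inner_self_nonneg) (hint p p)).1 h0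
    have hEq := Measure.eqOn_open_of_ae_eq hz isOpen_interior
      ((hcont p).inner (hcont p)).continuousOn continuousOn_const
    have hzero : ∀ x ∈ K.cell, p.1 x = 0 := fun x hx => inner_self_eq_zero.1 (hEq hx)
    obtain ⟨a, c, hac⟩ := p.2
    obtain ⟨x₀, hx₀⟩ := Element.cell_nonempty K
    have hc : c = 0 := by
      have h := isOpen_interior.mem_nhds hx₀
      have hlim : Filter.Tendsto (fun t : ℝ => x₀ + t • (EuclideanSpace.single 0 1 : Plane))
          (nhdsWithin 0 {0}ᶜ) (nhds x₀) := by
        have : Continuous (fun t : ℝ => x₀ + t • (EuclideanSpace.single 0 1 : Plane)) := by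
          fun_prop
        simpa using (this.tendsto 0).mono_left nhdsWithin_le_nhds
      obtain ⟨t, ht, ht0⟩ := ((hlim.eventually h).and self_mem_nhdsWithin).exists
      have e1 := hzero _ ht
      have e2 := hzero _ hx₀
      rw [hac] at e1 e2
      have e3 : (c * t) • (EuclideanSpace.single 0 1 : Plane) = 0 := by
        rw [mul_smul]
        have := congrArg₂ (· - ·) e1 e2
        simpa [smul_add] using this
      rcases smul_eq_zero.1 e3 with h | h
      · exact (mul_eq_zero.1 h).resolve_right ht0
      · exact absurd (congrArg (fun w : Plane => w 0) h) (by simp)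
    have ha : a = 0 := by
      have e2 := hzero _ hx₀
      rw [hac, hc] at e2
      simpa using e2
    ext1; funext x
    rw [hac, ha, hc]; simp
  have hsurj : Function.Surjective B :=
    (LinearMap.injective_iff_surjective_of_finrank_eq_finrank
      Subspace.dual_finrank_eq.symm).1 hinj
  obtain ⟨p, hp⟩ := hsurj F
  refine ⟨p.1, ⟨p.2, fun q hq => LinearMap.congr_fun hp ⟨q, hq⟩⟩, ?_⟩
  rintro p' ⟨hp', h⟩
  have : B ⟨p', hp'⟩ = B p := by
    rw [hp]
    exact LinearMap.ext fun q => h q.1 q.2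
  exact congrArg Subtype.val (hinj this)

end Existence

/-- The weak gradient of `v` on the element `K`. -/
def weakGradient {T : TriangularMesh Ω} (v : DiscreteFunction T) (K : T.Element) : Plane → Plane :=
  (existsUnique_isWeakGradient v K).exists.choose

/-- `u` is a weak Galerkin approximation with diffusion matrix `A`, right-hand side `f` and discrete
boundary data `g`: `u_b = g` on the boundary edges, and `(A ∇_w u, ∇_w v) = (f, v₀)` for every `v` in
`V_h` with `v_b = 0` on the boundary edges. -/
def IsWeakGalerkinSolution (T : TriangularMesh Ω) (A : Plane → Matrix (Fin 2) (Fin 2) ℝ)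
    (f : Plane → ℝ) (g : {e : T.Edge // e.IsBoundary} → ℝ) (u : DiscreteFunction T) : Prop :=
  (∀ e, u.edge e.1 = g e) ∧
    ∀ v : DiscreteFunction T, (∀ e : T.Edge, e.IsBoundary → v.edge e = 0) →
      ∑ K : T.Element,
          ∫ x in K.cell, matForm (A x) (weakGradient v K x) (weakGradient u K x) =
        ∑ K : T.Element, ∫ x in K.cell, f x * v.elem K

/-- The average `A_K` of `A` over the element `K`. -/
def average {T : TriangularMesh Ω} (A : Plane → Matrix (Fin 2) (Fin 2) ℝ) (K : T.Element) :
    Matrix (Fin 2) (Fin 2) ℝ :=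
  Matrix.of fun i j => ⨍ x in K.cell, A x i j

/-- `λ_{min,K}(A)`: the infimum over the interior of `K` of the minimal eigenvalue of `A x`. -/
def lambdaMin {T : TriangularMesh Ω} (A : Plane → Matrix (Fin 2) (Fin 2) ℝ) (K : T.Element) : ℝ :=
  ⨅ x : K.cell, sInf (spectrum ℝ (A x))

/-- The cosine of the angle at `p` between the segments from `p` to `q` and from `p` to `r`, measured
in the metric given by `G`. -/
def cosAngle (G : Matrix (Fin 2) (Fin 2) ℝ) (p q r : Plane) : ℝ :=
  matForm G (q - p) (r - p) /
    (Real.sqrt (matForm G (q - p) (q - p)) * Real.sqrt (matForm G (r - p) (r - p)))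

end WeakGalerkin

end

noncomputable section

namespace WeakGalerkin

open TriangularMesh

variable {Ω : Set Plane} {T : TriangularMesh Ω}

/-! Take an element `K` with centre of mass `x_K`, and let `N_i` be its outward normals scaled by
the edge lengths. Since `x - x_K` is orthogonal to constants, the weak gradient splits as `grad v +
slope v • (x - x_K)`: `grad v` is `1/|K|` times the sum of the `v_i N_i` and sees only edge values,
while `slope v` measures the mean of the edge values minus the element value.

Testing with the indicator of one element expresses `slope u` through `grad u` and `∫ f`, so the
element values can be eliminated. With `m = ∫ A (x - x_K)` and `D = ∫ (x - x_K)ᵀ A (x - x_K)`, what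
remains on edge values is the form of `S = |K| A_K - m mᵀ / D`, with load `∑ v_i w_i ∫ f`; the
weights `w_i` have sum 1. The Lipschitz condition makes `m` small, because `A` may be replaced by `A
- A(x_K)` in it. The two hypotheses have separate roles. The angle condition gives `N_iᵀ S N_j ≤ 0`
for `i ≠ j` (`schur_normal_nonpos`), since `N_iᵀ A_K N_j` is a negative multiple of the cosine of an
angle in the metric `A_K⁻¹`. The shape condition gives `w_i ≥ 0` (`weight_nonneg`).

Let `M` bound the boundary values and test with `v = (u_b - M)⁺`. The signs of `S` and the
coercivity of `S` (`schur_coercive`, `matForm_schur_posPart`) bound the left side below by a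
positive multiple of `‖grad v‖²` on each element, and the right side is nonpositive. Hence `grad v =
0`, so `v` is constant on the edges of each element; an extremal argument in the mesh
(`eq_zero_of_constant_on_elements`) yields `v = 0`. Finally, each element value is a convex
combination of its edge values plus a nonnegative multiple of `∫ f` (`elem_eq`). -/

/-- The determinant of two vectors of the plane. -/
def cross (u v : Plane) : ℝ := u 0 * v 1 - u 1 * v 0

/-! ### Integrals of affine functions over a triangle -/

/-- The closed triangle with vertices `(0, 0)`, `(1, 0)`, `(0, 1)`. -/
def refTriangle : Set Plane := {z | 0 ≤ z 0 ∧ 0 ≤ z 1 ∧ z 0 + z 1 ≤ 1}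

lemma isClosed_refTriangle : IsClosed refTriangle := by
  have h0 : Continuous fun z : Plane => z 0 := by fun_prop
  have h1 : Continuous fun z : Plane => z 1 := by fun_prop
  exact (isClosed_le continuous_const h0).inter
    ((isClosed_le continuous_const h1).inter (isClosed_le (h0.add h1) continuous_const))

lemma convex_refTriangle : Convex ℝ refTriangle := by
  rintro x ⟨hx0, hx1, hx⟩ y ⟨hy0, hy1, hy⟩ a b ha hb hab
  refine ⟨?_, ?_, ?_⟩ <;> simp only [PiLp.add_apply, PiLp.smul_apply, smul_eq_mul]
  · positivity
  · positivity
  · nlinarith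

lemma integral_refTriangle (g : ℝ × ℝ → ℝ) (hg : Continuous g) :
    ∫ z in refTriangle, g (z 0, z 1) = ∫ s in Icc (0 : ℝ) 1, ∫ t in Icc (0 : ℝ) (1 - s), g (s, t) := by
  have hmp := (volume_preserving_finTwoArrow ℝ).comp
    (EuclideanSpace.volume_preserving_symm_measurableEquiv_toLp (Fin 2))
  set e : Plane ≃ᵐ ℝ × ℝ := (MeasurableEquiv.toLp 2 (Fin 2 → ℝ)).symm.trans
    MeasurableEquiv.finTwoArrow with he
  have hmp' : MeasurePreserving e volume volume := hmp
  let T : Set (ℝ × ℝ) := {w | 0 ≤ w.1 ∧ 0 ≤ w.2 ∧ w.1 + w.2 ≤ 1}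
  have hT : IsClosed T := (isClosed_le continuous_const continuous_fst).inter
    ((isClosed_le continuous_const continuous_snd).inter
      (isClosed_le (continuous_fst.add continuous_snd) continuous_const))
  have hTc : IsCompact T := by
    refine (isCompact_Icc (a := ((0 : ℝ), (0 : ℝ))) (b := (1, 1))).of_isClosed_subset hT ?_
    rintro ⟨s, t⟩ ⟨h1, h2, h3⟩
    simp only at h1 h2 h3
    exact ⟨⟨h1, h2⟩, ⟨by simp only; linarith, by simp only; linarith⟩⟩
  have h1 : ∫ z in refTriangle, g (z 0, z 1) = ∫ w in T, g w :=
    hmp'.setIntegral_preimage_emb e.measurableEmbedding g T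
  have hint : Integrable (T.indicator g) (volume : Measure (ℝ × ℝ)) :=
    (integrable_indicator_iff hT.measurableSet).2 (hg.continuousOn.integrableOn_compact hTc)
  rw [h1, ← integral_indicator hT.measurableSet, Measure.volume_eq_prod,
    integral_prod _ (by rwa [Measure.volume_eq_prod] at hint),
    ← integral_indicator measurableSet_Icc]
  congr 1
  funext s
  by_cases hs : s ∈ Icc (0 : ℝ) 1
  · rw [indicator_of_mem hs, ← integral_indicator measurableSet_Icc]
    congr 1
    funext t
    by_cases ht : t ∈ Icc (0 : ℝ) (1 - s)
    · rw [indicator_of_mem ht, indicator_of_mem]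
      exact ⟨hs.1, ht.1, by simp only; linarith [ht.2]⟩
    · rw [indicator_of_notMem ht, indicator_of_notMem]
      rintro ⟨-, h2, h3⟩
      exact ht ⟨h2, by simp only at h3; linarith⟩
  · rw [indicator_of_notMem hs]
    have : ∀ t, T.indicator g (s, t) = 0 := fun t => by
      rw [indicator_of_notMem]
      rintro ⟨h1, h2, h3⟩
      simp only at h1 h2 h3
      exact hs ⟨h1, by linarith⟩
    simp [this]

lemma integral_Icc_affine (p q r s : ℝ) (hs : s ≤ 1) :
    ∫ t in Icc (0 : ℝ) (1 - s), (p + q * s + r * t) =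
      (p + q * s) * (1 - s) + r * ((1 - s) ^ 2 / 2) := by
  rw [integral_Icc_eq_integral_Ioc, ← intervalIntegral.integral_of_le (by linarith),
    intervalIntegral.integral_add (by simp) (by apply Continuous.intervalIntegrable; fun_prop),
    intervalIntegral.integral_const_mul, integral_id]
  simp
  ring

lemma integral_refTriangle_affine (p q r : ℝ) :
    ∫ z in refTriangle, (p + q * z 0 + r * z 1) = p / 2 + q / 6 + r / 6 := by
  have h := integral_refTriangle (fun w => p + q * w.1 + r * w.2) (by fun_prop)
  simp only at h
  rw [h, setIntegral_congr_fun measurableSet_Icc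
    (fun s hs => integral_Icc_affine p q r s hs.2), integral_Icc_eq_integral_Ioc,
    ← intervalIntegral.integral_of_le zero_le_one]
  have hd : ∀ s ∈ uIcc (0 : ℝ) 1, HasDerivAt
      (fun s : ℝ => p * (s - s ^ 2 / 2) + q * (s ^ 2 / 2 - s ^ 3 / 3) - r * ((1 - s) ^ 3 / 6))
      ((p + q * s) * (1 - s) + r * ((1 - s) ^ 2 / 2)) s := by
    intro s _
    have h1 := hasDerivAt_id s
    have := (((h1.sub ((h1.pow 2).div_const 2)).const_mul p).add
      ((((h1.pow 2).div_const 2).sub ((h1.pow 3).div_const 3)).const_mul q)).sub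
      (((((h1.const_sub 1).pow 3)).div_const 6).const_mul r)
    refine this.congr_deriv ?_
    simp
    ring
  rw [intervalIntegral.integral_eq_sub_of_hasDerivAt hd
    (by apply Continuous.intervalIntegrable; fun_prop)]
  ring

/-- The affine map of the plane that sends the vertices of the reference triangle to `a`, `a + u`,
`a + v`. -/
def affMap (a u v : Plane) (z : Plane) : Plane := a + (z 0 • u + z 1 • v)

/-- The linear part of `affMap`. -/
def linMap (u v : Plane) : Plane →L[ℝ] Plane :=
  (EuclideanSpace.proj (0 : Fin 2)).smulRight u + (EuclideanSpace.proj (1 : Fin 2)).smulRight v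

lemma det_linMap (u v : Plane) : (linMap u v).det = cross u v := by
  rw [ContinuousLinearMap.det,
    ← LinearMap.det_toMatrix (EuclideanSpace.basisFun (Fin 2) ℝ).toBasis, Matrix.det_fin_two]
  simp [LinearMap.toMatrix_apply, linMap, cross]
  ring

lemma hasFDerivAt_affMap (a u v z : Plane) : HasFDerivAt (affMap a u v) (linMap u v) z :=
  (linMap u v).hasFDerivAt.const_add a

lemma affMap_injective (a : Plane) {u v : Plane} (h : cross u v ≠ 0) :
    Function.Injective (affMap a u v) := by
  intro z w hzw
  have e := fun i : Fin 2 => congrArg (fun x : Plane => x i) hzw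
  have e0 := e 0
  have e1 := e 1
  simp only [affMap, PiLp.add_apply, PiLp.smul_apply, smul_eq_mul] at e0 e1
  ext i
  fin_cases i
  · refine mul_right_cancel₀ h ?_
    simp only [cross, Fin.zero_eta, Fin.isValue]
    linear_combination v 1 * e0 - v 0 * e1
  · refine mul_right_cancel₀ h ?_
    simp only [cross, Fin.mk_one, Fin.isValue]
    linear_combination u 0 * e1 - u 1 * e0

lemma convexHull_triple (a b c : Plane) :
    convexHull ℝ {a, b, c} = affMap a (b - a) (c - a) '' refTriangle := by
  apply Subset.antisymm
  · refine convexHull_min ?_ ?_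
    · rintro x (rfl | rfl | rfl)
      · exact ⟨0, by simp [refTriangle], by simp [affMap]⟩
      · exact ⟨EuclideanSpace.single 0 1, by simp [refTriangle], by simp [affMap]⟩
      · exact ⟨EuclideanSpace.single 1 1, by simp [refTriangle], by simp [affMap]⟩
    · have : affMap a (b - a) (c - a) '' refTriangle =
          (fun z => a + z) '' (linMap (b - a) (c - a) '' refTriangle) := by
        rw [image_image]; rfl
      rw [this]
      exact (convex_refTriangle.is_linear_image
        (linMap (b - a) (c - a)).toLinearMap.isLinear).translate a
  · rintro _ ⟨z, ⟨h0, h1, h2⟩, rfl⟩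
    have hm := fun x hx => subset_convexHull ℝ ({a, b, c} : Set Plane) (a := x) hx
    have h := (convex_convexHull ℝ ({a, b, c} : Set Plane)).sum_mem
      (t := Finset.univ) (w := ![1 - z 0 - z 1, z 0, z 1]) (z := ![a, b, c])
      (by intro i _; fin_cases i <;> simp <;> linarith) (by simp [Fin.sum_univ_three]; ring)
      (by intro i _; fin_cases i <;> exact hm _ (by simp))
    convert h using 1
    simp only [affMap, Fin.sum_univ_three, Matrix.cons_val]
    module

/-- The frontier of a convex set is null, so the closed triangle may be used; it is the affine image
of the reference triangle, with Jacobian `|cross (b - a) (c - a)|`. -/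
lemma integral_interior_triangle_affine {a b c : Plane} (h : cross (b - a) (c - a) ≠ 0)
    (g : Plane → ℝ) (p q r : ℝ)
    (hg : ∀ z, g (affMap a (b - a) (c - a) z) = p + q * z 0 + r * z 1) :
    ∫ x in interior (convexHull ℝ {a, b, c}), g x =
      |cross (b - a) (c - a)| * (p / 2 + q / 6 + r / 6) := by
  have h0 := (convex_convexHull ℝ ({a, b, c} : Set Plane)).addHaar_frontier volume
  rw [setIntegral_congr_set (interior_ae_eq_of_null_frontier h0), convexHull_triple,
    integral_image_eq_integral_abs_det_fderiv_smul volume isClosed_refTriangle.measurableSet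
      (fun x _ => (hasFDerivAt_affMap a _ _ x).hasFDerivWithinAt)
      (affMap_injective a h).injOn]
  simp only [hg, det_linMap, smul_eq_mul]
  rw [integral_const_mul, integral_refTriangle_affine]

lemma volume_real_interior_triangle {a b c : Plane} (h : cross (b - a) (c - a) ≠ 0) :
    volume.real (interior (convexHull ℝ {a, b, c})) = |cross (b - a) (c - a)| / 2 := by
  have := integral_interior_triangle_affine h (fun _ => 1) 1 0 0 (by simp)
  simp only [integral_const, smul_eq_mul, mul_one, measureReal_restrict_apply_univ] at this
  rw [this]; ring

lemma integral_interior_triangle_sub_centroid {a b c : Plane} (h : cross (b - a) (c - a) ≠ 0)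
    (i : Fin 2) :
    ∫ x in interior (convexHull ℝ {a, b, c}), (x - (3 : ℝ)⁻¹ • (a + b + c)) i = 0 := by
  rw [integral_interior_triangle_affine h (fun x => (x - (3 : ℝ)⁻¹ • (a + b + c)) i)
    (a i - 3⁻¹ * (a i + b i + c i)) (b i - a i) (c i - a i)]
  · ring
  · intro z
    simp [affMap]
    ring

/-- With zero determinant the triangle is the image of a set under a singular affine map, hence
null, while a nonempty open set has positive measure. -/
lemma cross_ne_zero_of_interior_nonempty {a b c : Plane}
    (h : (interior (convexHull ℝ {a, b, c})).Nonempty) : cross (b - a) (c - a) ≠ 0 := by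
  intro h0
  have hv : volume (convexHull ℝ {a, b, c}) = 0 := by
    have : convexHull ℝ {a, b, c} = (fun z => a + z) '' (linMap (b - a) (c - a) '' refTriangle) := by
      rw [convexHull_triple, image_image]; rfl
    rw [this, image_add_left, measure_preimage_add, Measure.addHaar_image_continuousLinearMap]
    change ENNReal.ofReal |(linMap (b - a) (c - a)).det| * _ = 0
    rw [det_linMap, h0]
    simp
  exact (isOpen_interior.measure_pos volume h).ne'
    (measure_mono_null interior_subset hv)

/-! ### Labelled triangles, normals and edge integrals -/

/-- A counterclockwise labelling of the vertices of an element, together with its edges: the edge `i`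
is opposite to the vertex `i`. -/
structure Labelling (K : T.Element) where
  vertex : Fin 3 → Plane
  edge : Fin 3 → T.Edge
  coe_eq : K.1 = {vertex 0, vertex 1, vertex 2}
  edge_eq : ∀ i, (edge i).1 = {vertex (i + 1), vertex (i + 2)}
  cross_pos : 0 < cross (vertex 1 - vertex 0) (vertex 2 - vertex 0)

lemma exists_labelling (K : T.Element) : Nonempty (Labelling K) := by
  obtain ⟨a, b, c, hab, hac, hbc, hK⟩ := Finset.card_eq_three.1 K.2.2
  have key : ∀ a b c : Plane, a ≠ b → a ≠ c → b ≠ c → K.1 = {a, b, c} →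
      0 < cross (b - a) (c - a) → Nonempty (Labelling K) := by
    intro a b c hab hac hbc hK hpos
    have hE : ∀ p q : Plane, p ≠ q → p ∈ K.1 → q ∈ K.1 → ∃ e : T.Edge, e.1 = {p, q} := by
      intro p q hpq hp hq
      refine ⟨⟨{p, q}, T.complex.down_closed K.2.1 ?_ (by simp), Finset.card_pair hpq⟩, rfl⟩
      intro x hx
      simp only [Finset.mem_insert, Finset.mem_singleton] at hx
      rcases hx with rfl | rfl <;> assumption
    obtain ⟨ea, ha⟩ := hE b c hbc (by simp [hK]) (by simp [hK])
    obtain ⟨eb, hb⟩ := hE c a hac.symm (by simp [hK]) (by simp [hK])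
    obtain ⟨ec, hc⟩ := hE a b hab (by simp [hK]) (by simp [hK])
    exact ⟨⟨![a, b, c], ![ea, eb, ec], hK, by intro i; fin_cases i <;> assumption, hpos⟩⟩
  have hne : cross (b - a) (c - a) ≠ 0 := by
    apply cross_ne_zero_of_interior_nonempty
    have := Element.cell_nonempty K
    simpa [Element.cell, Element.closedCell, hK] using this
  rcases hne.lt_or_gt with h | h
  · refine key a c b hac hab hbc.symm (by rw [hK, Finset.pair_comm b c]) ?_
    have : cross (c - a) (b - a) = - cross (b - a) (c - a) := by simp only [cross]; ring
    linarith
  · exact key a b c hab hac hbc hK h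

/-- The rotation of the plane by `-π / 2`. -/
def rot (u : Plane) : Plane := !₂[u 1, -u 0]

lemma inner_plane (u v : Plane) : inner ℝ u v = u 0 * v 0 + u 1 * v 1 := by
  simp [PiLp.inner_apply, Fin.sum_univ_two]
  ring

lemma norm_sq_plane (u : Plane) : ‖u‖ ^ 2 = u 0 ^ 2 + u 1 ^ 2 := by
  rw [← real_inner_self_eq_norm_sq, inner_plane]; ring

lemma norm_rot (u : Plane) : ‖rot u‖ = ‖u‖ := by
  rw [← sq_eq_sq₀ (norm_nonneg _) (norm_nonneg _), norm_sq_plane, norm_sq_plane]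
  simp [rot]; ring

namespace Labelling

variable {K : T.Element} (l : Labelling K)

/-- Twice the area. -/
def det : ℝ := cross (l.vertex 1 - l.vertex 0) (l.vertex 2 - l.vertex 0)

lemma det_pos : 0 < l.det := l.cross_pos

/-- The vector along the edge `i`, in counterclockwise direction. -/
def tangent (i : Fin 3) : Plane := l.vertex (i + 2) - l.vertex (i + 1)

/-- The outward normal of the edge `i`, as long as the edge. -/
def normal (i : Fin 3) : Plane := rot (l.tangent i)

/-- The center of mass of the element. -/
def centroid : Plane := (3 : ℝ)⁻¹ • (l.vertex 0 + l.vertex 1 + l.vertex 2)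

/-- The second moment of the element about its center of mass. -/
def inertia : ℝ := ∫ x in K.cell, ‖x - l.centroid‖ ^ 2

lemma cross_eq_det (i : Fin 3) :
    cross (l.vertex (i + 1) - l.vertex i) (l.vertex (i + 2) - l.vertex i) = l.det := by
  fin_cases i <;> simp [det, cross] <;> ring

lemma vertex_injective : Function.Injective l.vertex := by
  have h : ∀ i, l.vertex (i + 1) ≠ l.vertex i ∧ l.vertex (i + 2) ≠ l.vertex i := by
    intro i
    have := l.det_pos
    rw [← l.cross_eq_det i] at this
    constructor <;> intro h <;> simp [h, cross] at this
  intro i j hij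
  have h0 := h 0
  have h1 := h 1
  have h2 := h 2
  fin_cases i <;> fin_cases j <;> simp_all

lemma closedCell_eq : K.closedCell = convexHull ℝ {l.vertex 0, l.vertex 1, l.vertex 2} := by
  simp [Element.closedCell, l.coe_eq]

lemma cell_eq : K.cell = interior (convexHull ℝ {l.vertex 0, l.vertex 1, l.vertex 2}) := by
  rw [Element.cell, l.closedCell_eq]

lemma area_eq : K.area = l.det / 2 := by
  rw [Element.area, l.cell_eq, volume_real_interior_triangle l.cross_pos.ne',
    abs_of_pos l.cross_pos, det]

lemma edge_ne_aux {i j : Fin 3} (h : l.edge i = l.edge j) : i = j := by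
  by_contra hij
  have h1 := congrArg Subtype.val h
  rw [l.edge_eq, l.edge_eq] at h1
  have hinj := l.vertex_injective
  have h2 : l.vertex j ∈ ({l.vertex (i + 1), l.vertex (i + 2)} : Finset Plane) := by
    have : j = i + 1 ∨ j = i + 2 := by
      clear h h1; revert i j; decide
    rcases this with h | h <;> simp [h]
  rw [h1] at h2
  simp only [Finset.mem_insert, Finset.mem_singleton, hinj.eq_iff] at h2
  clear h h1
  revert h2
  fin_cases j <;> simp

lemma edge_injective : Function.Injective l.edge := fun _ _ => l.edge_ne_aux

lemma edges_eq [DecidableEq T.Edge] : K.edges = Finset.univ.image l.edge := by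
  ext e
  simp only [Element.edges, Finset.mem_filter, Finset.mem_univ, true_and, Finset.mem_image]
  constructor
  · intro he
    obtain ⟨p, q, hpq, hpe⟩ := Finset.card_eq_two.1 e.2.2
    rw [hpe, l.coe_eq] at he
    have hp : p ∈ ({l.vertex 0, l.vertex 1, l.vertex 2} : Finset Plane) := he (by simp)
    have hq : q ∈ ({l.vertex 0, l.vertex 1, l.vertex 2} : Finset Plane) := he (by simp)
    have key : ∀ i, ((l.vertex (i + 1) = p ∧ l.vertex (i + 2) = q) ∨
        (l.vertex (i + 1) = q ∧ l.vertex (i + 2) = p)) → l.edge i = e := by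
      intro i h
      apply Subtype.ext
      rw [l.edge_eq, hpe]
      rcases h with ⟨h1, h2⟩ | ⟨h1, h2⟩
      · rw [h1, h2]
      · rw [h1, h2, Finset.pair_comm]
    simp only [Finset.mem_insert, Finset.mem_singleton] at hp hq
    rcases hp with rfl | rfl | rfl <;> rcases hq with rfl | rfl | rfl <;>
      first
      | exact absurd rfl hpq
      | exact ⟨0, key 0 (Or.inl ⟨rfl, rfl⟩)⟩
      | exact ⟨0, key 0 (Or.inr ⟨rfl, rfl⟩)⟩
      | exact ⟨1, key 1 (Or.inl ⟨rfl, rfl⟩)⟩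
      | exact ⟨1, key 1 (Or.inr ⟨rfl, rfl⟩)⟩
      | exact ⟨2, key 2 (Or.inl ⟨rfl, rfl⟩)⟩
      | exact ⟨2, key 2 (Or.inr ⟨rfl, rfl⟩)⟩
  · rintro ⟨i, rfl⟩
    rw [l.edge_eq, l.coe_eq]
    intro x hx
    fin_cases i <;> simp at hx ⊢ <;> tauto

lemma sum_edges (F : T.Edge → ℝ) : ∑ e ∈ K.edges, F e = ∑ i, F (l.edge i) := by
  classical
  rw [l.edges_eq, Finset.sum_image fun i _ j _ h => l.edge_injective h]

lemma sum_vertices : ∑ x ∈ K.1, x = l.vertex 0 + l.vertex 1 + l.vertex 2 := by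
  have h := l.vertex_injective
  rw [l.coe_eq, Finset.sum_insert, Finset.sum_pair, add_assoc]
  · exact h.ne (by decide)
  · simp [h.eq_iff]

lemma norm_normal (i : Fin 3) : ‖l.normal i‖ = dist (l.vertex (i + 1)) (l.vertex (i + 2)) := by
  rw [normal, norm_rot, tangent, dist_comm, dist_eq_norm]

lemma norm_normal_pos (i : Fin 3) : 0 < ‖l.normal i‖ := by
  rw [norm_normal, dist_pos, l.vertex_injective.ne_iff]
  fin_cases i <;> decide

lemma sum_normal : ∑ i, l.normal i = 0 := by
  simp only [Fin.sum_univ_three, normal, rot, tangent]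
  ext i
  fin_cases i <;> simp

/-- The centroid lies at a third of the height above each edge, and height times length is `l.det`.
That the value is constant along the edge reduces the boundary integrals to edge lengths. -/
lemma inner_sub_centroid_normal (i : Fin 3) {x : Plane}
    (hx : x ∈ (l.edge i).closedCell) : inner ℝ (x - l.centroid) (l.normal i) = l.det / 3 := by
  have : (l.edge i).closedCell = segment ℝ (l.vertex (i + 1)) (l.vertex (i + 2)) := by
    rw [Edge.closedCell, l.edge_eq]; simp [convexHull_pair]
  rw [this] at hx
  obtain ⟨s, t, -, -, hst, rfl⟩ := hx
  obtain rfl : s = 1 - t := by linarith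
  rw [inner_plane, ← l.cross_eq_det i]
  fin_cases i <;> simp [centroid, normal, rot, tangent, cross] <;> ring

/-- The vector from centroid to midpoint has inner product `l.det / 3 > 0` with `l.normal i`, so its
projection orthogonal to the edge is a positive multiple of that normal. -/
lemma outwardNormal_eq (i : Fin 3) :
    outwardNormal K (l.edge i) = ‖l.normal i‖⁻¹ • l.normal i := by
  have hN := l.norm_normal_pos i
  have hδ := l.det_pos
  have hne : l.vertex (i + 1) ≠ l.vertex (i + 2) := by
    rw [l.vertex_injective.ne_iff]; fin_cases i <;> decide
  have hm : (2 : ℝ)⁻¹ • (l.vertex (i + 1) + l.vertex (i + 2)) ∈ (l.edge i).closedCell := by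
    rw [Edge.closedCell, l.edge_eq]
    simp only [Finset.coe_insert, Finset.coe_singleton, convexHull_pair]
    exact ⟨2⁻¹, 2⁻¹, by norm_num, by norm_num, by norm_num, by rw [smul_add]⟩
  have hinner := l.inner_sub_centroid_normal i hm
  have hproj : (vectorSpan ℝ ((l.edge i).1 : Set Plane))ᗮ.starProjection
      ((2 : ℝ)⁻¹ • ∑ x ∈ (l.edge i).1, x - (3 : ℝ)⁻¹ • ∑ x ∈ K.1, x) =
      (l.det / 3 / ‖l.normal i‖ ^ 2) • l.normal i := by
    rw [l.sum_vertices, l.edge_eq, Finset.sum_pair hne]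
    simp only [Finset.coe_insert, Finset.coe_singleton]
    have horth : ∀ w ∈ vectorSpan ℝ ({l.vertex (i + 1), l.vertex (i + 2)} : Set Plane),
        inner ℝ w (l.normal i) = 0 := by
      intro w hw
      rw [vectorSpan_pair_rev, Submodule.mem_span_singleton] at hw
      obtain ⟨t, rfl⟩ := hw
      rw [inner_smul_left, inner_plane]
      simp [normal, rot, tangent]
      right
      ring
    refine Submodule.eq_starProjection_of_mem_of_inner_eq_zero ?_ ?_
    · exact Submodule.smul_mem _ _ ((Submodule.mem_orthogonal _ _).2 horth)
    · intro w hw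
      -- In the plane, the orthogonal complement of the tangent is the line of the normal.
      have hwn : ∃ t : ℝ, w = t • l.normal i := by
        have h1 := (Submodule.mem_orthogonal _ _).1 hw (l.tangent i) (by
          rw [vectorSpan_pair_rev]; exact Submodule.mem_span_singleton_self _)
        refine ⟨inner ℝ w (l.normal i) / ‖l.normal i‖ ^ 2, ?_⟩
        have h2 : ‖l.normal i‖ ^ 2 = l.tangent i 0 ^ 2 + l.tangent i 1 ^ 2 := by
          rw [normal, norm_rot, norm_sq_plane]
        have h3 : ‖l.normal i‖ ^ 2 ≠ 0 := by positivity
        rw [inner_plane] at h1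
        rw [inner_plane]
        ext k
        rw [PiLp.smul_apply, smul_eq_mul, div_mul_eq_mul_div, eq_div_iff h3, h2]
        fin_cases k <;> simp [normal, rot]
        · linear_combination l.tangent i 0 * h1
        · linear_combination l.tangent i 1 * h1
      obtain ⟨t, rfl⟩ := hwn
      rw [inner_smul_right, inner_sub_left, inner_smul_left, real_inner_self_eq_norm_sq]
      change t * (inner ℝ (_ - l.centroid) _ - _) = 0
      rw [hinner]
      simp
      field_simp
      simp
  simp only [outwardNormal]
  rw [hproj, norm_smul, Real.norm_of_nonneg (by positivity), smul_smul]
  congr 1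
  field_simp

lemma edge_integral (i : Fin 3) (r c : ℝ) (a : Plane) :
    ∫ x in (l.edge i).closedCell,
      r * inner ℝ (a + c • (x - l.centroid)) (outwardNormal K (l.edge i))
        ∂(Measure.hausdorffMeasure 1 : Measure Plane) =
      r * (inner ℝ a (l.normal i) + c * (l.det / 3)) := by
  have hN := l.norm_normal_pos i
  have hseg : (l.edge i).closedCell = segment ℝ (l.vertex (i + 1)) (l.vertex (i + 2)) := by
    rw [Edge.closedCell, l.edge_eq]; simp [convexHull_pair]
  have hc : IsCompact (l.edge i).closedCell := (l.edge i).1.finite_toSet.isCompact_convexHull ℝ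
  rw [setIntegral_congr_fun (g := fun _ => r * (‖l.normal i‖⁻¹ *
    (inner ℝ a (l.normal i) + c * (l.det / 3)))) hc.measurableSet]
  · simp only [integral_const, smul_eq_mul, measureReal_restrict_apply_univ]
    rw [measureReal_def, hseg, hausdorffMeasure_segment, edist_dist,
      ENNReal.toReal_ofReal dist_nonneg, ← l.norm_normal]
    field_simp
  · intro x hx
    simp only
    rw [l.outwardNormal_eq, inner_smul_right, inner_add_left, inner_smul_left,
      l.inner_sub_centroid_normal i hx]
    simp

end Labelling

/-! ### The weak gradient in closed form -/

lemma divergence_affine (a : Plane) (c : ℝ) (x₀ x : Plane) :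
    divergence (fun x => a + c • (x - x₀)) x = 2 * c := by
  have h : HasFDerivAt (fun x : Plane => a + c • (x - x₀))
      (c • ContinuousLinearMap.id ℝ Plane) x :=
    (((hasFDerivAt_id x).sub_const x₀).const_smul c).const_add a
  simp [divergence, h.fderiv]

lemma Element.area_pos (K : T.Element) : 0 < K.area := by
  obtain ⟨l⟩ := exists_labelling K
  rw [l.area_eq]; linarith [l.det_pos]

namespace Labelling

variable {K : T.Element} (l : Labelling K)

lemma integral_inner_sub_centroid (a : Plane) :
    ∫ x in K.cell, inner ℝ a (x - l.centroid) = 0 := by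
  have h : ∀ i : Fin 2, IntegrableOn (fun x : Plane => a i * (x - l.centroid) i) K.cell :=
    fun i => Element.integrableOn K (by fun_prop)
  simp only [inner_plane]
  rw [integral_add (h 0) (h 1), integral_const_mul, integral_const_mul, l.cell_eq]
  simp only [centroid]
  rw [integral_interior_triangle_sub_centroid l.cross_pos.ne',
    integral_interior_triangle_sub_centroid l.cross_pos.ne']
  simp

lemma integral_inner_affine (a b : Plane) (c d : ℝ) :
    ∫ x in K.cell, inner ℝ (a + c • (x - l.centroid)) (b + d • (x - l.centroid)) =
      K.area * inner ℝ a b + c * d * l.inertia := by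
  have e : ∀ x : Plane, (inner ℝ (a + c • (x - l.centroid)) (b + d • (x - l.centroid)) : ℝ) =
      (inner ℝ a b + d * inner ℝ a (x - l.centroid) + c * inner ℝ b (x - l.centroid)) +
        c * d * ‖x - l.centroid‖ ^ 2 := by
    intro x
    simp only [inner_add_left, inner_add_right, real_inner_smul_left, real_inner_smul_right,
      real_inner_self_eq_norm_sq, real_inner_comm b (x - l.centroid)]
    ring
  simp only [e]
  have hi := fun (g : Plane → ℝ) (hg : Continuous g) => Element.integrableOn K hg
  rw [integral_add (hi _ (by fun_prop)) (hi _ (by fun_prop)),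
    integral_add (hi _ (by fun_prop)) (hi _ (by fun_prop)),
    integral_add (hi _ (by fun_prop)) (hi _ (by fun_prop)), integral_const_mul,
    integral_const_mul, integral_const_mul, integral_inner_sub_centroid,
    integral_inner_sub_centroid]
  simp [Element.area, inertia, measureReal_def]

lemma inertia_pos : 0 < l.inertia := by
  have h0 : 0 ≤ l.inertia := integral_nonneg fun x => by positivity
  refine lt_of_le_of_ne h0 fun h => ?_
  have hint : IntegrableOn (fun x => ‖x - l.centroid‖ ^ 2) K.cell :=
    Element.integrableOn K (by fun_prop)
  have hz := (setIntegral_eq_zero_iff_of_nonneg_ae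
    (Filter.Eventually.of_forall fun x => by positivity) hint).1 h.symm
  have hc : Continuous fun x : Plane => ‖x - l.centroid‖ ^ 2 := by fun_prop
  have hEq := Measure.eqOn_open_of_ae_eq hz isOpen_interior hc.continuousOn continuousOn_const
  have hsub : K.cell ⊆ {l.centroid} := fun x hx => by
    have := hEq hx
    simpa [sub_eq_zero] using this
  have hpos : 0 < volume K.cell := isOpen_interior.measure_pos volume (Element.cell_nonempty K)
  exact hpos.ne' (measure_mono_null hsub (measure_singleton _))

/-- The constant part of the weak gradient. -/
def grad (v : DiscreteFunction T) : Plane := (2 / l.det) • ∑ i, v.edge (l.edge i) • l.normal i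

/-- The mean of the three edge values of a discrete function. -/
def edgeMean (v : DiscreteFunction T) : ℝ := (∑ i, v.edge (l.edge i)) / 3

/-- The coefficient of `x - l.centroid` in the weak gradient. -/
def slope (v : DiscreteFunction T) : ℝ :=
  l.det * (l.edgeMean v - v.elem K) / l.inertia

/-- By uniqueness it suffices to check the defining identity. For test fields `b + d (x - x_K)` the
constant and linear parts decouple, one equation fixing `grad` and the other `slope`. -/
theorem weakGradient_eq (v : DiscreteFunction T) :
    weakGradient v K = fun x => l.grad v + l.slope v • (x - l.centroid) := by
  refine (existsUnique_isWeakGradient v K).unique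
    (existsUnique_isWeakGradient v K).exists.choose_spec ⟨?_, ?_⟩
  · exact ⟨l.grad v - l.slope v • l.centroid, l.slope v, fun x => by simp only [smul_sub]; abel⟩
  · rintro q ⟨b, d, hq⟩
    obtain rfl : q = fun x => (b + d • l.centroid) + d • (x - l.centroid) := by
      funext x; rw [hq, smul_sub]; abel
    simp only [divergence_affine]
    rw [l.integral_inner_affine, l.sum_edges]
    simp only [l.edge_integral]
    have hI := l.inertia_pos
    have hδ := l.det_pos
    rw [slope, grad, edgeMean, inner_smul_left, sum_inner]
    simp only [inner_smul_left, integral_const, measureReal_restrict_apply_univ, smul_eq_mul]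
    rw [← Element.area, l.area_eq]
    simp only [Fin.sum_univ_three, real_inner_comm (l.normal _)]
    simp
    field_simp
    ring

end Labelling

/-! ### Bounds for symmetric matrices -/

lemma matForm_eq (B : Matrix (Fin 2) (Fin 2) ℝ) (u v : Plane) :
    matForm B u v =
      B 0 0 * (u 0 * v 0) + B 0 1 * (u 0 * v 1) + B 1 0 * (u 1 * v 0) + B 1 1 * (u 1 * v 1) := by
  simp [matForm, Matrix.mulVec, dotProduct, Fin.sum_univ_two]
  ring

lemma abs_matForm_le (B : Matrix (Fin 2) (Fin 2) ℝ) (u v : Plane) :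
    |matForm B u v| ≤ ‖B‖ * ‖u‖ * ‖v‖ := by
  have h1 : matForm B u v = inner ℝ u (Matrix.toEuclideanCLM (𝕜 := ℝ) B v) := by
    rw [matForm_eq, inner_plane]
    simp [Matrix.mulVec, dotProduct, Fin.sum_univ_two]
    ring
  rw [h1]
  refine (abs_real_inner_le_norm _ _).trans ?_
  have h2 : ‖Matrix.toEuclideanCLM (𝕜 := ℝ) B v‖ ≤ ‖B‖ * ‖v‖ :=
    (Matrix.toEuclideanCLM (𝕜 := ℝ) B).le_opNorm v
  nlinarith [norm_nonneg u]

lemma abs_entry_le (B : Matrix (Fin 2) (Fin 2) ℝ) (i j : Fin 2) : |B i j| ≤ ‖B‖ := by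
  have h := abs_matForm_le B (EuclideanSpace.single i 1) (EuclideanSpace.single j 1)
  have : matForm B (EuclideanSpace.single i 1) (EuclideanSpace.single j 1) = B i j := by
    rw [matForm_eq]
    fin_cases i <;> fin_cases j <;> simp
  simpa [this] using h

lemma spectrum_real_nonempty {B : Matrix (Fin 2) (Fin 2) ℝ} (hB : B.IsSymm) :
    (spectrum ℝ B).Nonempty := by
  have hH : B.IsHermitian := by
    rw [Matrix.IsHermitian, Matrix.conjTranspose_eq_transpose_of_trivial]; exact hB
  rw [hH.spectrum_real_eq_range_eigenvalues]
  exact range_nonempty _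

lemma le_of_mem_spectrum {B : Matrix (Fin 2) (Fin 2) ℝ} {c : ℝ}
    (h : ∀ ξ : Plane, c * ‖ξ‖ ^ 2 ≤ matForm B ξ ξ) {μ : ℝ} (hμ : μ ∈ spectrum ℝ B) : c ≤ μ := by
  rw [← Matrix.spectrum_toLin', ← Module.End.hasEigenvalue_iff_mem_spectrum] at hμ
  obtain ⟨v, hv⟩ := hμ.exists_hasEigenvector
  have hv1 := hv.apply_eq_smul
  have h1 := h (WithLp.toLp 2 v)
  have h2 : matForm B (WithLp.toLp 2 v) (WithLp.toLp 2 v) = μ * ‖(WithLp.toLp 2 v : Plane)‖ ^ 2 := by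
    rw [Matrix.toLin'_apply] at hv1
    rw [matForm, hv1, norm_sq_plane]
    simp [dotProduct, Fin.sum_univ_two]
    ring
  rw [h2] at h1
  refine le_of_mul_le_mul_right h1 ?_
  have : (WithLp.toLp 2 v : Plane) ≠ 0 := fun h => hv.2 (by simpa using congrArg WithLp.ofLp h)
  positivity

lemma sInf_spectrum_mul_norm_sq_le {B : Matrix (Fin 2) (Fin 2) ℝ} (hB : B.IsSymm) {c : ℝ}
    (hc : c ≤ sInf (spectrum ℝ B)) (ξ : Plane) : c * ‖ξ‖ ^ 2 ≤ matForm B ξ ξ := by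
  have hH : B.IsHermitian := by
    rw [Matrix.IsHermitian, Matrix.conjTranspose_eq_transpose_of_trivial]; exact hB
  have hbdd : BddBelow (spectrum ℝ B) := by
    rw [hH.spectrum_real_eq_range_eigenvalues]
    exact (finite_range _).bddBelow
  have hpsd : (B - algebraMap ℝ _ c).PosSemidef := by
    rw [Matrix.posSemidef_iff_isHermitian_and_spectrum_nonneg]
    refine ⟨hH.sub (by simp [Matrix.algebraMap_eq_diagonal]), ?_⟩
    intro μ hμ
    rw [mem_ofPred_eq]
    have : μ + c ∈ spectrum ℝ B := by
      have := (spectrum.add_mem_add_iff (r := μ) (s := c) (a := B - algebraMap ℝ _ c)).2 hμ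
      simpa [add_comm] using this
    linarith [csInf_le hbdd this]
  have := hpsd.dotProduct_mulVec_nonneg ξ.ofLp
  simp [Matrix.algebraMap_eq_diagonal, dotProduct, Matrix.mulVec,
    Fin.sum_univ_two] at this
  rw [matForm_eq, norm_sq_plane]
  nlinarith

/-! ### Membership in a triangle -/

/-- The three cross products, divided by `cross (b - a) (c - a)`, are the barycentric coordinates of
`x`. -/
lemma mem_convexHull_triple {a b c : Plane} (h : 0 < cross (b - a) (c - a)) (x : Plane) :
    x ∈ convexHull ℝ {a, b, c} ↔
      0 ≤ cross (b - a) (x - a) ∧ 0 ≤ cross (c - b) (x - b) ∧ 0 ≤ cross (a - c) (x - c) := by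
  rw [convexHull_triple]
  constructor
  · rintro ⟨z, ⟨h0, h1, h2⟩, rfl⟩
    have e1 : cross (b - a) (affMap a (b - a) (c - a) z - a) = z 1 * cross (b - a) (c - a) := by
      simp [cross, affMap]; ring
    have e2 : cross (c - b) (affMap a (b - a) (c - a) z - b) =
        (1 - z 0 - z 1) * cross (b - a) (c - a) := by
      simp [cross, affMap]; ring
    have e3 : cross (a - c) (affMap a (b - a) (c - a) z - c) = z 0 * cross (b - a) (c - a) := by
      simp [cross, affMap]; ring
    rw [e1, e2, e3]
    exact ⟨by positivity, mul_nonneg (by linarith) h.le, by positivity⟩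
  · rintro ⟨h1, h2, h3⟩
    have hs : cross (b - a) (x - a) + cross (c - b) (x - b) + cross (a - c) (x - c) =
        cross (b - a) (c - a) := by
      simp [cross]; ring
    refine ⟨!₂[cross (a - c) (x - c) / cross (b - a) (c - a),
      cross (b - a) (x - a) / cross (b - a) (c - a)], ⟨?_, ?_, ?_⟩, ?_⟩
    · simp; positivity
    · simp; positivity
    · simp
      rw [← add_div, div_le_one h]
      linarith
    · ext i
      simp only [affMap, PiLp.add_apply, PiLp.smul_apply, smul_eq_mul]
      simp
      field_simp
      fin_cases i <;> simp [cross] <;> ring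

lemma cross_pos_of_mem_interior {a b c x : Plane} (h : 0 < cross (b - a) (c - a))
    (hx : x ∈ interior (convexHull ℝ {a, b, c})) : 0 < cross (b - a) (x - a) := by
  have h1 := ((mem_convexHull_triple h x).1 (interior_subset hx)).1
  refine lt_of_le_of_ne h1 fun h0 => ?_
  -- If `x` were on the line `ab`, a small move away from `c` would stay in the triangle and yet
  -- cross that line.
  have hlim : Filter.Tendsto (fun t : ℝ => x + t • (x - c)) (nhdsWithin 0 (Ioi 0)) (nhds x) := by
    have : Continuous (fun t : ℝ => x + t • (x - c)) := by fun_prop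
    simpa using (this.tendsto 0).mono_left nhdsWithin_le_nhds
  obtain ⟨t, ht, ht0⟩ := ((hlim.eventually (isOpen_interior.mem_nhds hx)).and
    self_mem_nhdsWithin).exists
  have h2 := ((mem_convexHull_triple h _).1 (interior_subset ht)).1
  have e : cross (b - a) (x + t • (x - c) - a) =
      (1 + t) * cross (b - a) (x - a) - t * cross (b - a) (c - a) := by
    simp [cross]; ring
  rw [e, ← h0] at h2
  have : 0 < t * cross (b - a) (c - a) := mul_pos ht0 h
  linarith

lemma mem_interior_convexHull_triple {a b c x : Plane} (h : 0 < cross (b - a) (c - a))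
    (h1 : 0 < cross (b - a) (x - a)) (h2 : 0 < cross (c - b) (x - b))
    (h3 : 0 < cross (a - c) (x - c)) : x ∈ interior (convexHull ℝ {a, b, c}) := by
  have hc : ∀ u v : Plane, Continuous fun x : Plane => cross u (x - v) := fun u v => by
    unfold cross; fun_prop
  refine mem_interior.2 ⟨{x | 0 < cross (b - a) (x - a)} ∩ ({x | 0 < cross (c - b) (x - b)} ∩
    {x | 0 < cross (a - c) (x - c)}), ?_, ?_, h1, h2, h3⟩
  · rintro y ⟨hy1, hy2, hy3⟩
    exact (mem_convexHull_triple h y).2 ⟨le_of_lt hy1, le_of_lt hy2, le_of_lt hy3⟩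
  · exact (isOpen_lt continuous_const (hc _ _)).inter
      ((isOpen_lt continuous_const (hc _ _)).inter (isOpen_lt continuous_const (hc _ _)))

namespace Labelling

variable {K : T.Element} (l : Labelling K)

lemma centroid_mem_cell : l.centroid ∈ K.cell := by
  have h := l.cross_pos
  rw [l.cell_eq]
  refine mem_interior_convexHull_triple h ?_ ?_ ?_ <;>
  · simp only [cross, centroid, PiLp.sub_apply, PiLp.smul_apply, PiLp.add_apply, smul_eq_mul] at h ⊢
    linarith

lemma isBounded_closedCell (K : T.Element) : Bornology.IsBounded K.closedCell :=
  (Element.isCompact K).isBounded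

lemma norm_sub_centroid_le {x : Plane} (hx : x ∈ K.cell) : ‖x - l.centroid‖ ≤ K.diam := by
  rw [← dist_eq_norm]
  exact Metric.dist_le_diam_of_mem (isBounded_closedCell K) (interior_subset hx)
    (interior_subset l.centroid_mem_cell)

lemma inertia_le : l.inertia ≤ K.diam ^ 2 * K.area := by
  have h : l.inertia ≤ ∫ _ in K.cell, K.diam ^ 2 := by
    refine setIntegral_mono_on (Element.integrableOn K (by fun_prop))
      (Element.integrableOn K (by fun_prop)) isOpen_interior.measurableSet fun x hx => ?_
    have := l.norm_sub_centroid_le hx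
    gcongr
  simpa [Element.area, measureReal_def, mul_comm] using h

lemma vertex_mem_closedCell (i : Fin 3) : l.vertex i ∈ K.closedCell := by
  rw [l.closedCell_eq]
  refine subset_convexHull ℝ _ ?_
  fin_cases i <;> simp

lemma norm_normal_le (i : Fin 3) : ‖l.normal i‖ ≤ K.diam := by
  rw [l.norm_normal]
  exact Metric.dist_le_diam_of_mem (isBounded_closedCell K) (l.vertex_mem_closedCell _)
    (l.vertex_mem_closedCell _)

end Labelling

/-! ### Algebra of the bilinear form of a matrix -/

lemma matForm_add_left (B : Matrix (Fin 2) (Fin 2) ℝ) (u u' v : Plane) :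
    matForm B (u + u') v = matForm B u v + matForm B u' v := by
  simp only [matForm_eq, PiLp.add_apply]; ring

lemma matForm_add_right (B : Matrix (Fin 2) (Fin 2) ℝ) (u v v' : Plane) :
    matForm B u (v + v') = matForm B u v + matForm B u v' := by
  simp only [matForm_eq, PiLp.add_apply]; ring

lemma matForm_smul_left (B : Matrix (Fin 2) (Fin 2) ℝ) (r : ℝ) (u v : Plane) :
    matForm B (r • u) v = r * matForm B u v := by
  simp only [matForm_eq, PiLp.smul_apply, smul_eq_mul]; ring

lemma matForm_smul_right (B : Matrix (Fin 2) (Fin 2) ℝ) (r : ℝ) (u v : Plane) :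
    matForm B u (r • v) = r * matForm B u v := by
  simp only [matForm_eq, PiLp.smul_apply, smul_eq_mul]; ring

lemma matForm_comm {B : Matrix (Fin 2) (Fin 2) ℝ} (hB : B.IsSymm) (u v : Plane) :
    matForm B u v = matForm B v u := by
  simp only [matForm_eq, hB.apply 0 1]; ring

/-- Ellipticity of a matrix with constant `c`. -/
def IsElliptic (c : ℝ) (B : Matrix (Fin 2) (Fin 2) ℝ) : Prop :=
  ∀ ξ : Plane, c * ‖ξ‖ ^ 2 ≤ matForm B ξ ξ

lemma IsElliptic.det_pos {c : ℝ} {B : Matrix (Fin 2) (Fin 2) ℝ} (hc : 0 < c)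
    (h : IsElliptic c B) (hB : B.IsSymm) : 0 < B.det := by
  have h1 := h (EuclideanSpace.single 0 1)
  -- The form takes the value `B 0 0 * B.det` at this vector.
  have h2 := h !₂[-B 0 1, B 0 0]
  rw [matForm_eq, norm_sq_plane] at h1 h2
  simp at h1 h2
  have h3 : 0 < B 0 0 := by linarith
  have h4 : 0 < B 0 0 * B.det := by
    rw [Matrix.det_fin_two]
    have e := hB.apply 0 1
    rw [e] at h2 ⊢
    have : 0 < c * (B 0 1 ^ 2 + B 0 0 ^ 2) := by positivity
    nlinarith
  exact (pos_iff_pos_of_mul_pos h4).1 h3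

/-- Conjugating a symmetric `2 × 2` matrix by a quarter turn gives its adjugate. This is how angles
in the metric of the inverse matrix enter. -/
lemma matForm_rot {B : Matrix (Fin 2) (Fin 2) ℝ} (hB : B.IsSymm) (hd : B.det ≠ 0) (u v : Plane) :
    matForm B (rot u) (rot v) = B.det * matForm B⁻¹ u v := by
  have e := hB.apply 0 1
  rw [Matrix.inv_def, Matrix.adjugate_fin_two]
  simp [matForm_eq, rot, e, Ring.inverse_eq_inv']
  field_simp
  ring

/-- The right side is `B.det` times the cosine times the two lengths in the metric `B⁻¹`.
Ellipticity at `rot w` bounds `√B.det` times the length of `w` in that metric below by `√c * ‖w‖`.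
-/
lemma le_matForm_rot {B : Matrix (Fin 2) (Fin 2) ℝ} (hB : B.IsSymm) {c : ℝ} (hc : 0 < c)
    (h : IsElliptic c B) {κ : ℝ} (hκ : 0 ≤ κ) {p q r : Plane} (hpq : q ≠ p) (hpr : r ≠ p)
    (hcos : κ ≤ cosAngle B⁻¹ p q r) :
    κ * c * (‖q - p‖ * ‖r - p‖) ≤ matForm B (rot (q - p)) (rot (r - p)) := by
  have hd := h.det_pos hc hB
  have key : ∀ w : Plane, w ≠ 0 → 0 < matForm B⁻¹ w w ∧
      √c * ‖w‖ ≤ √B.det * √(matForm B⁻¹ w w) := by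
    intro w hw
    have h1 := h (rot w)
    rw [norm_rot, matForm_rot hB hd.ne'] at h1
    have h2 : 0 < c * ‖w‖ ^ 2 := by positivity
    refine ⟨(pos_iff_pos_of_mul_pos (h2.trans_le h1)).1 hd, ?_⟩
    rw [← Real.sqrt_mul hd.le, ← Real.sqrt_sq (norm_nonneg w), ← Real.sqrt_mul hc.le]
    exact Real.sqrt_le_sqrt h1
  obtain ⟨q0, q1⟩ := key _ (sub_ne_zero.2 hpq)
  obtain ⟨r0, r1⟩ := key _ (sub_ne_zero.2 hpr)
  rw [matForm_rot hB hd.ne']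
  rw [cosAngle, le_div_iff₀ (by positivity)] at hcos
  have hm := mul_le_mul q1 r1 (by positivity) (by positivity)
  have e1 := Real.mul_self_sqrt hc.le
  have e2 := Real.mul_self_sqrt hd.le
  calc κ * c * (‖q - p‖ * ‖r - p‖) = κ * (√c * ‖q - p‖ * (√c * ‖r - p‖)) := by
        rw [← e1]; simp only [Real.sqrt_mul_self (Real.sqrt_nonneg c)]; ring
    _ ≤ κ * (√B.det * √(matForm B⁻¹ (q - p) (q - p)) *
          (√B.det * √(matForm B⁻¹ (r - p) (r - p)))) := by gcongr
    _ = B.det * (κ * (√(matForm B⁻¹ (q - p) (q - p)) * √(matForm B⁻¹ (r - p) (r - p)))) := by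
        linear_combination (κ * √(matForm B⁻¹ (q - p) (q - p)) *
          √(matForm B⁻¹ (r - p) (r - p))) * e2
    _ ≤ _ := by gcongr

/-! ### Moments of the diffusion matrix on one element -/

/-- The coefficient matrix is symmetric, elliptic with constant `c`, and Lipschitz with constant `L` on
the element `K`. -/
structure IsDiffusion (A : Plane → Matrix (Fin 2) (Fin 2) ℝ) (K : T.Element) (c L : ℝ) : Prop where
  symm : ∀ x ∈ K.cell, (A x).IsSymm
  pos : 0 < c
  elliptic : ∀ x ∈ K.cell, IsElliptic c (A x)
  lip : ∀ x ∈ K.cell, ∀ y ∈ K.cell, ‖A x - A y‖ ≤ L * ‖x - y‖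

namespace IsDiffusion

variable {A : Plane → Matrix (Fin 2) (Fin 2) ℝ} {K : T.Element} {c L : ℝ}

lemma lip_nonneg (h : IsDiffusion A K c L) : 0 ≤ L := by
  obtain ⟨x, hx⟩ := Element.cell_nonempty K
  obtain ⟨y, hy, hxy⟩ : ∃ y ∈ K.cell, y ≠ x := by
    by_contra! hall
    have hpos : 0 < volume K.cell := isOpen_interior.measure_pos volume ⟨x, hx⟩
    exact hpos.ne' (measure_mono_null (t := {x}) hall (measure_singleton _))
  have := (norm_nonneg _).trans (h.lip y hy x hx)
  exact nonneg_of_mul_nonneg_left this (norm_pos_iff.2 (sub_ne_zero.2 hxy))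

/-- Nothing is known about `A` outside the open cell, so a Lipschitz extension of the entry to the
whole plane supplies a continuous integrand. -/
lemma entry_integrableOn (h : IsDiffusion A K c L) (i j : Fin 2) {g : Plane → ℝ}
    (hg : Continuous g) : IntegrableOn (fun x => A x i j * g x) K.cell := by
  have hlip : LipschitzOnWith (Real.toNNReal L) (fun x => A x i j) K.cell :=
    LipschitzOnWith.of_dist_le_mul fun x hx y hy => by
      rw [Real.coe_toNNReal _ h.lip_nonneg, Real.dist_eq, dist_eq_norm]
      exact (abs_entry_le (A x - A y) i j).trans (h.lip x hx y hy)
  obtain ⟨G, hG, hEq⟩ := hlip.extend_real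
  refine (Element.integrableOn K (hG.continuous.mul hg)).congr_fun (fun x hx => ?_)
    isOpen_interior.measurableSet
  have := hEq hx
  simp only at this
  simp only [Pi.mul_apply, this]

lemma integrableOn (h : IsDiffusion A K c L) {p q : Plane → Plane} (hp : Continuous p)
    (hq : Continuous q) : IntegrableOn (fun x => matForm (A x) (p x) (q x)) K.cell := by
  simp only [matForm_eq]
  exact (((h.entry_integrableOn 0 0 (by fun_prop)).add (h.entry_integrableOn 0 1 (by fun_prop))).add
    (h.entry_integrableOn 1 0 (by fun_prop))).add (h.entry_integrableOn 1 1 (by fun_prop))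

lemma area_mul_matForm_average (h : IsDiffusion A K c L) (a b : Plane) :
    K.area * matForm (average A K) a b = ∫ x in K.cell, matForm (A x) a b := by
  have hi := fun i j (r : ℝ) => h.entry_integrableOn i j (continuous_const (y := r))
  have ha := (Element.area_pos K).ne'
  have hav : ∀ i j, average A K i j = K.area⁻¹ * ∫ x in K.cell, A x i j := by
    intro i j
    rw [average, Matrix.of_apply, setAverage_eq, smul_eq_mul]
    rfl
  have h2 : IntegrableOn (fun x => A x 0 0 * (a 0 * b 0) + A x 0 1 * (a 0 * b 1)) K.cell :=
    (hi 0 0 _).add (hi 0 1 _)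
  have h3 : IntegrableOn (fun x => A x 0 0 * (a 0 * b 0) + A x 0 1 * (a 0 * b 1) +
      A x 1 0 * (a 1 * b 0)) K.cell := h2.add (hi 1 0 _)
  simp only [matForm_eq]
  rw [integral_add h3 (hi 1 1 _), integral_add h2 (hi 1 0 _), integral_add (hi 0 0 _) (hi 0 1 _)]
  simp only [integral_mul_const, hav]
  field_simp

lemma average_isSymm (h : IsDiffusion A K c L) : (average A K).IsSymm := by
  ext i j
  simp only [Matrix.transpose_apply, average, Matrix.of_apply, setAverage_eq]
  congr 1
  exact setIntegral_congr_fun isOpen_interior.measurableSet fun x hx => (h.symm x hx).apply i j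

lemma average_isElliptic (h : IsDiffusion A K c L) : IsElliptic c (average A K) := by
  intro ξ
  refine le_of_mul_le_mul_left ?_ (Element.area_pos K)
  rw [h.area_mul_matForm_average]
  have := setIntegral_mono_on (Element.integrableOn K (continuous_const (y := c * ‖ξ‖ ^ 2)))
    (h.integrableOn continuous_const continuous_const) isOpen_interior.measurableSet
    fun x hx => h.elliptic x hx ξ
  simpa [Element.area, measureReal_def] using this

end IsDiffusion

namespace Labelling

variable {K : T.Element} (l : Labelling K)

/-- The first moment `∫ A (x - x_K)` of the coefficient matrix. -/
def moment (A : Plane → Matrix (Fin 2) (Fin 2) ℝ) : Plane :=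
  !₂[∫ x in K.cell, matForm (A x) (EuclideanSpace.single 0 1) (x - l.centroid),
    ∫ x in K.cell, matForm (A x) (EuclideanSpace.single 1 1) (x - l.centroid)]

/-- The second moment `∫ (x - x_K)ᵀ A (x - x_K)` of the coefficient matrix. -/
def energy (A : Plane → Matrix (Fin 2) (Fin 2) ℝ) : ℝ :=
  ∫ x in K.cell, matForm (A x) (x - l.centroid) (x - l.centroid)

/-- The form on constant vectors that is left after the elimination of the element value. -/
def schur (A : Plane → Matrix (Fin 2) (Fin 2) ℝ) : Matrix (Fin 2) (Fin 2) ℝ :=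
  K.area • average A K - (l.energy A)⁻¹ • Matrix.of fun i j => l.moment A i * l.moment A j

variable {A : Plane → Matrix (Fin 2) (Fin 2) ℝ} {c L : ℝ}

lemma matForm_schur (a b : Plane) : matForm (l.schur A) a b =
    K.area * matForm (average A K) a b -
      inner ℝ a (l.moment A) * inner ℝ b (l.moment A) / l.energy A := by
  simp only [matForm_eq, schur, inner_plane, Matrix.sub_apply, Matrix.smul_apply, Matrix.of_apply,
    smul_eq_mul]
  ring

lemma inner_moment (h : IsDiffusion A K c L) (a : Plane) :
    inner ℝ a (l.moment A) = ∫ x in K.cell, matForm (A x) a (x - l.centroid) := by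
  have e : ∀ x, matForm (A x) a (x - l.centroid) =
      a 0 * matForm (A x) (EuclideanSpace.single 0 1) (x - l.centroid) +
        a 1 * matForm (A x) (EuclideanSpace.single 1 1) (x - l.centroid) := by
    intro x; simp [matForm_eq]; ring
  simp only [e]
  rw [integral_add ((h.integrableOn (by fun_prop) (by fun_prop)).const_mul _)
    ((h.integrableOn (by fun_prop) (by fun_prop)).const_mul _), integral_const_mul,
    integral_const_mul, inner_plane]
  simp [moment]

lemma integral_matForm_affine (h : IsDiffusion A K c L) (a b : Plane) (r s : ℝ) :
    ∫ x in K.cell, matForm (A x) (a + r • (x - l.centroid)) (b + s • (x - l.centroid)) =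
      K.area * matForm (average A K) a b + s * inner ℝ a (l.moment A) +
        r * inner ℝ b (l.moment A) + r * s * l.energy A := by
  have h1 := h.integrableOn (p := fun _ => a) (q := fun _ => b) (by fun_prop) (by fun_prop)
  have h2 := (h.integrableOn (p := fun _ => a) (q := fun x => x - l.centroid) (by fun_prop)
    (by fun_prop)).const_mul s
  have h3 := (h.integrableOn (p := fun _ => b) (q := fun x => x - l.centroid) (by fun_prop)
    (by fun_prop)).const_mul r
  have h4 := (h.integrableOn (p := fun x => x - l.centroid) (q := fun x => x - l.centroid)
    (by fun_prop) (by fun_prop)).const_mul (r * s)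
  have h12 : IntegrableOn (fun x => matForm (A x) a b + s * matForm (A x) a (x - l.centroid))
    K.cell := h1.add h2
  have h123 : IntegrableOn (fun x => matForm (A x) a b + s * matForm (A x) a (x - l.centroid) +
    r * matForm (A x) b (x - l.centroid)) K.cell := h12.add h3
  rw [h.area_mul_matForm_average, l.inner_moment h, l.inner_moment h, energy,
    ← integral_const_mul, ← integral_const_mul, ← integral_const_mul, ← integral_add h1 h2,
    ← integral_add h12 h3, ← integral_add h123 h4]
  refine setIntegral_congr_fun isOpen_interior.measurableSet fun x hx => ?_
  simp only [matForm_add_left, matForm_add_right, matForm_smul_left, matForm_smul_right,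
    matForm_comm (h.symm x hx) (x - l.centroid) b]
  ring

lemma le_integral_matForm_affine (h : IsDiffusion A K c L) (a : Plane) (r : ℝ) :
    c * (K.area * ‖a‖ ^ 2 + r ^ 2 * l.inertia) ≤ K.area * matForm (average A K) a a +
      2 * r * inner ℝ a (l.moment A) + r ^ 2 * l.energy A := by
  have h1 := l.integral_matForm_affine h a a r r
  have h2 := l.integral_inner_affine a a r r
  have hc : Continuous fun x : Plane => a + r • (x - l.centroid) := by fun_prop
  have h3 := setIntegral_mono_on ((Element.integrableOn K (hc.inner hc)).const_mul c)
    (h.integrableOn hc hc) isOpen_interior.measurableSet fun x hx => by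
      rw [real_inner_self_eq_norm_sq]; exact h.elliptic x hx _
  rw [integral_const_mul, h1, h2, real_inner_self_eq_norm_sq] at h3
  linarith

lemma le_energy (h : IsDiffusion A K c L) : c * l.inertia ≤ l.energy A := by
  have := l.le_integral_matForm_affine h 0 1
  simp [matForm_eq] at this
  exact this

lemma energy_pos (h : IsDiffusion A K c L) : 0 < l.energy A :=
  (mul_pos h.pos l.inertia_pos).trans_le (l.le_energy h)

lemma schur_coercive (h : IsDiffusion A K c L) (a : Plane) :
    c * K.area * ‖a‖ ^ 2 ≤ matForm (l.schur A) a a := by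
  have hD := l.energy_pos h
  -- This `r` minimizes the quadratic in `r` on the right of the energy inequality; the minimum is
  -- the form of `l.schur A`.
  have h1 := l.le_integral_matForm_affine h a (-(inner ℝ a (l.moment A) / l.energy A))
  have h2 : 0 ≤ c * ((-(inner ℝ a (l.moment A) / l.energy A)) ^ 2 * l.inertia) :=
    mul_nonneg h.pos.le (mul_nonneg (sq_nonneg _) l.inertia_pos.le)
  rw [matForm_schur]
  have e : 2 * -(inner ℝ a (l.moment A) / l.energy A) * inner ℝ a (l.moment A) +
      (-(inner ℝ a (l.moment A) / l.energy A)) ^ 2 * l.energy A =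
      -(inner ℝ a (l.moment A) * inner ℝ a (l.moment A) / l.energy A) := by
    field_simp; ring
  linarith

/-- Since `x - x_K` has mean zero, `A x` may be replaced by `A x - A x_K`, whose norm is at most `L
‖x - x_K‖`; the second factor `‖x - x_K‖` completes the inertia. -/
lemma abs_inner_moment_le (h : IsDiffusion A K c L) (a : Plane) :
    |inner ℝ a (l.moment A)| ≤ L * l.inertia * ‖a‖ := by
  have h0 : ∫ x in K.cell, matForm (A l.centroid) a (x - l.centroid) = 0 := by
    have e : ∀ x, matForm (A l.centroid) a (x - l.centroid) =
        inner ℝ (!₂[matForm (A l.centroid) a (EuclideanSpace.single 0 1),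
          matForm (A l.centroid) a (EuclideanSpace.single 1 1)] : Plane) (x - l.centroid) := by
      intro x; rw [inner_plane]; simp [matForm_eq]; ring
    simp only [e, l.integral_inner_sub_centroid]
  have hc : Continuous fun x : Plane => matForm (A l.centroid) a (x - l.centroid) := by
    simp only [matForm_eq]; fun_prop
  have hi := h.integrableOn (p := fun _ => a) (q := fun x => x - l.centroid) (by fun_prop)
    (by fun_prop)
  rw [l.inner_moment h, ← sub_zero (∫ x in K.cell, _), ← h0,
    ← integral_sub hi (Element.integrableOn K hc)]
  refine abs_integral_le_integral_abs.trans ?_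
  have hb : ∫ x in K.cell, L * ‖a‖ * ‖x - l.centroid‖ ^ 2 = L * l.inertia * ‖a‖ := by
    rw [integral_const_mul, inertia]; ring
  rw [← hb]
  refine setIntegral_mono_on (hi.sub (Element.integrableOn K hc)).abs
    (Element.integrableOn K (by fun_prop)) isOpen_interior.measurableSet fun x hx => ?_
  have e : matForm (A x) a (x - l.centroid) - matForm (A l.centroid) a (x - l.centroid) =
      matForm (A x - A l.centroid) a (x - l.centroid) := by
    simp only [matForm_eq, Matrix.sub_apply]; ring
  simp only [e]
  refine (abs_matForm_le _ _ _).trans ?_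
  have := h.lip x hx _ l.centroid_mem_cell
  calc _ ≤ L * ‖x - l.centroid‖ * ‖a‖ * ‖x - l.centroid‖ := by gcongr
    _ = _ := by ring

/-- Two edges meet at a vertex `p`. Going counterclockwise, one of them enters `p` and the other
leaves it, which accounts for the minus sign. -/
lemma exists_matForm_normal (B : Matrix (Fin 2) (Fin 2) ℝ) {i j : Fin 3} (hij : i ≠ j) :
    ∃ p q r, p ∈ K.1 ∧ q ∈ K.1 ∧ r ∈ K.1 ∧ p ≠ q ∧ p ≠ r ∧ q ≠ r ∧
      ‖l.normal i‖ = ‖q - p‖ ∧ ‖l.normal j‖ = ‖r - p‖ ∧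
      matForm B (l.normal i) (l.normal j) = -matForm B (rot (q - p)) (rot (r - p)) := by
  have hinj := l.vertex_injective
  have hmem : ∀ k, l.vertex k ∈ K.1 := by
    intro k; rw [l.coe_eq]; fin_cases k <;> simp
  obtain ⟨k, hki, hkj, hk⟩ : ∃ k, k ≠ i ∧ k ≠ j ∧
      ((j = i + 1 ∧ k = i + 2) ∨ (i = j + 1 ∧ k = j + 2)) := by
    revert i j; decide
  refine ⟨l.vertex k, l.vertex j, l.vertex i, hmem k, hmem j, hmem i, hinj.ne hkj, hinj.ne hki,
    hinj.ne hij.symm, ?_, ?_, ?_⟩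
  · rw [normal, norm_rot, tangent]
    rcases hk with ⟨rfl, rfl⟩ | ⟨rfl, rfl⟩
    · rw [norm_sub_rev]
    · fin_cases j <;> simp
  · rw [normal, norm_rot, tangent]
    rcases hk with ⟨rfl, rfl⟩ | ⟨rfl, rfl⟩
    · fin_cases i <;> simp
    · rw [norm_sub_rev]
  · rcases hk with ⟨rfl, rfl⟩ | ⟨rfl, rfl⟩
    · fin_cases i <;> simp [normal, tangent, matForm_eq, rot] <;> ring
    · fin_cases j <;> simp [normal, tangent, matForm_eq, rot] <;> ring

/-- The angle condition makes the part from `A_K` at most `-|K| (L² h² / c) X`, with `X` the product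
of the edge lengths. The rank-one part is at most `(L I)² X / (c I)` with `I` the inertia, and `I ≤
h² |K|`, so the two bounds cancel exactly. -/
lemma schur_normal_nonpos (h : IsDiffusion A K c L)
    (hangle : ∀ p ∈ K.1, ∀ q ∈ K.1, ∀ r ∈ K.1, p ≠ q → p ≠ r → q ≠ r →
      L ^ 2 * K.diam ^ 2 / c ^ 2 ≤ cosAngle (average A K)⁻¹ p q r) {i j : Fin 3} (hij : i ≠ j) :
    matForm (l.schur A) (l.normal i) (l.normal j) ≤ 0 := by
  obtain ⟨p, q, r, hp, hq, hr, hpq, hpr, hqr, hi, hj, hB⟩ :=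
    l.exists_matForm_normal (average A K) hij
  have h1 := le_matForm_rot h.average_isSymm h.pos h.average_isElliptic
    (by positivity) hpq.symm hpr.symm (hangle p hp q hq r hr hpq hpr hqr)
  rw [← hi, ← hj] at h1
  have hc := h.pos
  have hI := l.inertia_pos
  have hD := l.energy_pos h
  have hK := Element.area_pos K
  set X := ‖l.normal i‖ * ‖l.normal j‖ with hX
  have hX0 : 0 ≤ X := by positivity
  rw [matForm_schur, hB]
  have h2 : -(inner ℝ (l.normal i) (l.moment A) * inner ℝ (l.normal j) (l.moment A) / l.energy A) ≤
      K.area * (L ^ 2 * K.diam ^ 2 / c * X) := by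
    have h3 : |inner ℝ (l.normal i) (l.moment A) * inner ℝ (l.normal j) (l.moment A)| ≤
        (L * l.inertia) ^ 2 * X := by
      rw [abs_mul]
      calc _ ≤ (L * l.inertia * ‖l.normal i‖) * (L * l.inertia * ‖l.normal j‖) :=
            mul_le_mul (l.abs_inner_moment_le h _) (l.abs_inner_moment_le h _) (abs_nonneg _)
              ((abs_nonneg _).trans (l.abs_inner_moment_le h _))
        _ = _ := by rw [hX]; ring
    rw [← neg_div]
    calc _ ≤ (L * l.inertia) ^ 2 * X / l.energy A := by
          gcongr; exact (neg_le_abs _).trans h3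
      _ ≤ (L * l.inertia) ^ 2 * X / (c * l.inertia) := by
          gcongr; exact l.le_energy h
      _ = L ^ 2 * X / c * l.inertia := by field_simp
      _ ≤ L ^ 2 * X / c * (K.diam ^ 2 * K.area) := by
          gcongr; exact l.inertia_le
      _ = _ := by ring
  have h4 : L ^ 2 * K.diam ^ 2 / c ^ 2 * c * X = L ^ 2 * K.diam ^ 2 / c * X := by field_simp
  rw [h4] at h1
  have h5 := mul_le_mul_of_nonneg_left h1 hK.le
  linarith

/-- From `|N_i · m| ≤ L I h`, `D ≥ c I`, `I ≤ h² |K|` and `l.det = 2 |K|`, the second term is at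
least `-L h³ / (2 c |K|)`, and the shape condition is precisely what keeps this above `-1/3`. -/
lemma weight_nonneg (h : IsDiffusion A K c L)
    (hshape : 0 < L → K.diam ^ 3 / K.area ≤ 2 * c / (3 * L)) (i : Fin 3) :
    0 ≤ 1 / 3 + 2 * l.inertia * inner ℝ (l.normal i) (l.moment A) / (l.det ^ 2 * l.energy A) := by
  have hc := h.pos
  have hI := l.inertia_pos
  have hD := l.energy_pos h
  have hδ := l.det_pos
  have hL := h.lip_nonneg
  have hdiam : 0 ≤ K.diam := Metric.diam_nonneg
  have hK := l.area_eq
  have hKpos := Element.area_pos K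
  have h1 : -(2 * l.inertia * inner ℝ (l.normal i) (l.moment A) / (l.det ^ 2 * l.energy A)) ≤
      L * (K.diam ^ 3 / K.area) / (2 * c) := by
    rw [← neg_div]
    calc _ ≤ 2 * l.inertia * (L * l.inertia * K.diam) / (l.det ^ 2 * (c * l.inertia)) := by
          refine div_le_div₀ (by positivity) ?_ (by positivity)
            (mul_le_mul_of_nonneg_left (l.le_energy h) (by positivity))
          have h2 := (neg_le_abs _).trans (l.abs_inner_moment_le h (l.normal i))
          have h3 : L * l.inertia * ‖l.normal i‖ ≤ L * l.inertia * K.diam := by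
            gcongr; exact l.norm_normal_le i
          rw [← mul_neg]
          gcongr
          linarith
      _ = 2 * (L * K.diam) / (l.det ^ 2 * c) * l.inertia := by field_simp
      _ ≤ 2 * (L * K.diam) / (l.det ^ 2 * c) * (K.diam ^ 2 * K.area) := by
          gcongr; exact l.inertia_le
      _ = _ := by
          have : l.det = 2 * K.area := by linarith
          rw [this]; field_simp
  have h2 : L * (K.diam ^ 3 / K.area) / (2 * c) ≤ 1 / 3 := by
    rcases hL.eq_or_lt with rfl | hL'
    · simp
    · have h3 := hshape hL'
      rw [div_le_iff₀ (by positivity)]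
      have h4 := mul_le_mul_of_nonneg_left h3 hL
      have : L * (2 * c / (3 * L)) = 1 / 3 * (2 * c) := by field_simp
      linarith
  linarith

end Labelling

/-! ### Open cells are disjoint -/

/-- If a vertex were missing from `s`, then `x` would lie on the line through the other two, where
an interior point cannot be. -/
lemma Element.subset_of_mem_convexHull {K : T.Element} {s : Finset Plane} {x : Plane}
    (hx : x ∈ K.cell) (hs : s ⊆ K.1) (hxs : x ∈ convexHull ℝ (s : Set Plane)) : K.1 ⊆ s := by
  obtain ⟨l⟩ := exists_labelling K
  have key : ∀ i, l.vertex i ∈ s := by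
    intro i
    by_contra hi
    have h1 := l.det_pos
    rw [← l.cross_eq_det i] at h1
    have h2 : 0 < cross (l.vertex (i + 2) - l.vertex (i + 1)) (l.vertex i - l.vertex (i + 1)) := by
      simp only [cross, PiLp.sub_apply] at h1 ⊢; linarith
    have h3 : x ∈ interior (convexHull ℝ {l.vertex (i + 1), l.vertex (i + 2), l.vertex i}) := by
      rw [l.cell_eq] at hx
      convert hx using 3
      fin_cases i
      · ext y; simp; tauto
      · ext y; simp; tauto
      · ext y; simp
    have h4 := cross_pos_of_mem_interior h2 h3
    have hsub : (s : Set Plane) ⊆ {l.vertex (i + 1), l.vertex (i + 2)} := by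
      intro y hy
      have hyK := hs hy
      rw [l.coe_eq] at hyK
      have hne : y ≠ l.vertex i := fun h => hi (h ▸ hy)
      fin_cases i <;> simp at hyK hne ⊢ <;> tauto
    have h5 := convexHull_mono hsub hxs
    rw [convexHull_pair] at h5
    obtain ⟨a, b, -, -, hab, rfl⟩ := h5
    obtain rfl : a = 1 - b := by linarith
    have : cross (l.vertex (i + 2) - l.vertex (i + 1))
        ((1 - b) • l.vertex (i + 1) + b • l.vertex (i + 2) - l.vertex (i + 1)) = 0 := by
      simp [cross]; ring
    linarith
  intro y hy
  rw [l.coe_eq] at hy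
  simp only [Finset.mem_insert, Finset.mem_singleton] at hy
  rcases hy with rfl | rfl | rfl <;> exact key _

lemma Edge.subset_of_mem_convexHull {e : T.Edge} {s : Finset Plane} {x : Plane}
    (hx : x ∈ e.cell) (hs : s ⊆ e.1) (hxs : x ∈ convexHull ℝ (s : Set Plane)) : e.1 ⊆ s := by
  by_contra hne
  have hlt : s.card < 2 := by
    rw [← e.2.2]; exact Finset.card_lt_card ⟨hs, hne⟩
  have hsub : (s : Set Plane).Subsingleton := fun a ha b hb =>
    Finset.card_le_one.1 (by omega) a ha b hb
  have hconv : Convex ℝ (s : Set Plane) := hsub.convex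
  rw [hconv.convexHull_eq] at hxs
  exact hx.2 (hs hxs)

lemma mem_convexHull_inter {s t : Finset Plane} (hs : s ∈ T.complex.faces)
    (ht : t ∈ T.complex.faces) {x : Plane} (hxs : x ∈ convexHull ℝ (s : Set Plane))
    (hxt : x ∈ convexHull ℝ (t : Set Plane)) :
    ∃ r : Finset Plane, r ⊆ s ∧ r ⊆ t ∧ x ∈ convexHull ℝ (r : Set Plane) := by
  classical
  refine ⟨s ∩ t, Finset.inter_subset_left, Finset.inter_subset_right, ?_⟩
  rw [Finset.coe_inter]
  exact T.complex.inter_subset_convexHull hs ht ⟨hxs, hxt⟩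

lemma Element.eq_of_mem_cell {K K' : T.Element} {x : Plane} (h : x ∈ K.cell) (h' : x ∈ K'.cell) :
    K = K' := by
  obtain ⟨r, h1, h2, h3⟩ := mem_convexHull_inter K.2.1 K'.2.1 (interior_subset h)
    (interior_subset h')
  exact Subtype.ext (((Element.subset_of_mem_convexHull h h1 h3).trans h2).antisymm
    ((Element.subset_of_mem_convexHull h' h2 h3).trans h1))

lemma Edge.eq_of_mem_cell {e e' : T.Edge} {x : Plane} (h : x ∈ e.cell) (h' : x ∈ e'.cell) :
    e = e' := by
  obtain ⟨r, h1, h2, h3⟩ := mem_convexHull_inter e.2.1 e'.2.1 h.1 h'.1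
  exact Subtype.ext (((Edge.subset_of_mem_convexHull h h1 h3).trans h2).antisymm
    ((Edge.subset_of_mem_convexHull h' h2 h3).trans h1))

lemma Element.notMem_edge_cell {K : T.Element} {e : T.Edge} {x : Plane} (h : x ∈ K.cell) :
    x ∉ e.cell := by
  intro h'
  obtain ⟨r, h1, h2, h3⟩ := mem_convexHull_inter K.2.1 e.2.1 (interior_subset h) h'.1
  have := Finset.card_le_card ((Element.subset_of_mem_convexHull h h1 h3).trans h2)
  rw [K.2.2, e.2.2] at this
  omega

/-- By disjointness of the open cells at most one term of the sums is nonzero. `0 ≤ M` covers the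
points that lie in none of them. -/
lemma DiscreteFunction.toFun_le (u : DiscreteFunction T) {M : ℝ} (hM : 0 ≤ M)
    (helem : ∀ K, u.elem K ≤ M) (hedge : ∀ e, u.edge e ≤ M) (x : Plane) : u.toFun x ≤ M := by
  rw [DiscreteFunction.toFun]
  by_cases hK : ∃ K : T.Element, x ∈ K.cell
  · obtain ⟨K, hK⟩ := hK
    rw [Finset.sum_eq_single K, Finset.sum_eq_zero, indicator_of_mem hK, add_zero]
    · exact helem K
    · intro e _
      exact indicator_of_notMem (Element.notMem_edge_cell hK) _
    · intro K' _ hne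
      exact indicator_of_notMem (fun h => hne (Element.eq_of_mem_cell h hK)) _
    · simp
  · push Not at hK
    rw [Finset.sum_eq_zero fun K _ => indicator_of_notMem (hK K) _, zero_add]
    by_cases he : ∃ e : T.Edge, x ∈ e.cell
    · obtain ⟨e, he⟩ := he
      rw [Finset.sum_eq_single e, indicator_of_mem he]
      · exact hedge e
      · intro e' _ hne
        exact indicator_of_notMem (fun h => hne (Edge.eq_of_mem_cell h he)) _
      · simp
    · push Not at he
      rwa [Finset.sum_eq_zero fun e _ => indicator_of_notMem (he e) _]

/-! ### The neighbour across an interior edge -/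

lemma isOpen_domain (T : TriangularMesh Ω) : IsOpen Ω := by
  rw [T.domain_eq]; exact isOpen_interior

lemma Element.cell_subset (K : T.Element) : K.cell ⊆ Ω :=
  (interior_mono (T.complex.convexHull_subset_space K.2.1)).trans T.domain_eq.ge

lemma Element.closedCell_subset_closure (K : T.Element) : K.closedCell ⊆ closure Ω := by
  have h : closure K.cell = closure K.closedCell :=
    (convex_convexHull ℝ _).closure_interior_eq_closure_of_nonempty_interior
      (Element.cell_nonempty K)
  exact subset_closure.trans (h ▸ closure_mono (Element.cell_subset K))

lemma exists_element_of_mem {x : Plane} (hx : x ∈ Ω) : ∃ K : T.Element, x ∈ K.closedCell := by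
  rw [T.domain_eq] at hx
  obtain ⟨s, hs, hxs⟩ := T.complex.mem_space_iff.1 (interior_subset hx)
  obtain ⟨K, hK, hcard, hsK⟩ := T.pure s hs
  exact ⟨⟨K, hK, hcard⟩, convexHull_mono hsK hxs⟩

lemma convexHull_subset_cross_nonneg {a b p q r : Plane} {κ : ℝ}
    (hp : 0 ≤ κ * cross a (p - b)) (hq : 0 ≤ κ * cross a (q - b)) (hr : 0 ≤ κ * cross a (r - b)) :
    convexHull ℝ {p, q, r} ⊆ {x | 0 ≤ κ * cross a (x - b)} := by
  refine convexHull_min ?_ ?_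
  · rintro x (rfl | rfl | rfl) <;> assumption
  · intro x hx y hy s t hs ht hst
    have hx' : 0 ≤ κ * cross a (x - b) := hx
    have hy' : 0 ≤ κ * cross a (y - b) := hy
    change 0 ≤ κ * cross a (s • x + t • y - b)
    have : κ * cross a (s • x + t • y - b) =
        s * (κ * cross a (x - b)) + t * (κ * cross a (y - b)) := by
      obtain rfl : s = 1 - t := by linarith
      simp [cross]; ring
    rw [this]
    positivity

/-- Not lying in `frontier Ω` only provides one point of the closed edge in `Ω`, possibly an end
point; as `Ω` is open, it can be shifted slightly towards the midpoint. -/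
lemma exists_mem_cell_of_not_isBoundary {K : T.Element} {e : T.Edge} (heK : e.1 ⊆ K.1)
    (he : ¬ e.IsBoundary) : ∃ z ∈ Ω, z ∈ e.cell := by
  obtain ⟨z₀, hz₀, hz₀'⟩ := not_subset.1 he
  have hΩ := isOpen_domain T
  have h1 : z₀ ∈ Ω := by
    by_contra h
    exact hz₀' ⟨Element.closedCell_subset_closure K (convexHull_mono heK hz₀), by
      rwa [hΩ.interior_eq]⟩
  obtain ⟨p, q, hpq, hpe⟩ := Finset.card_eq_two.1 e.2.2
  have hseg : e.closedCell = segment ℝ p q := by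
    rw [Edge.closedCell, hpe]; simp [convexHull_pair]
  rw [hseg, segment_eq_image_lineMap] at hz₀
  obtain ⟨s, hs, rfl⟩ := hz₀
  have hc : Continuous fun t : ℝ => AffineMap.lineMap p q (s + t * (2⁻¹ - s)) :=
    AffineMap.lineMap_continuous.comp (by fun_prop)
  have hlim : Filter.Tendsto (fun t : ℝ => AffineMap.lineMap p q (s + t * (2⁻¹ - s)))
      (nhdsWithin 0 (Ioi 0)) (nhds (AffineMap.lineMap p q s)) := by
    simpa using (hc.tendsto 0).mono_left nhdsWithin_le_nhds
  have hlt : ∀ᶠ t : ℝ in nhdsWithin 0 (Ioi 0), t < 1 :=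
    nhdsWithin_le_nhds (eventually_lt_nhds zero_lt_one)
  obtain ⟨t, ⟨ht, ht1⟩, ht0⟩ := (((hlim.eventually (hΩ.mem_nhds h1)).and hlt).and
    self_mem_nhdsWithin).exists
  have ht0' : 0 < t := ht0
  have hpos : 0 < s + t * (2⁻¹ - s) := by nlinarith [hs.1, hs.2]
  have hlt1 : s + t * (2⁻¹ - s) < 1 := by nlinarith [hs.1, hs.2]
  refine ⟨_, ht, ?_, ?_⟩
  · rw [hseg, segment_eq_image_lineMap]
    exact ⟨_, ⟨hpos.le, hlt1.le⟩, rfl⟩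
  · rw [hpe]
    simp only [Finset.coe_insert, Finset.coe_singleton, mem_insert_iff, mem_singleton_iff, not_or]
    constructor
    · rw [AffineMap.lineMap_eq_left_iff]
      simp [hpq, hpos.ne']
    · rw [AffineMap.lineMap_eq_right_iff]
      simp [hpq, hlt1.ne]

/-- From a point `z` of the open edge inside `Ω`, step slightly away from `r`. The new point lies in
an element `K'` that also contains `z`; conformity forces the edge into `K'`, and `K'` cannot lie on
the side of `r`. -/
theorem exists_neighbor {K : T.Element} {e : T.Edge} {p q r : Plane} (hK : K.1 = {p, q, r})
    (hpe : e.1 = {p, q}) (he : ¬ e.IsBoundary) :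
    ∃ (K' : T.Element) (r' : Plane), K'.1 = {p, q, r'} ∧
      cross (q - p) (r - p) * cross (q - p) (r' - p) < 0 := by
  have heK : e.1 ⊆ K.1 := by rw [hK, hpe]; intro x; simp; tauto
  obtain ⟨z, hzΩ, hze⟩ := exists_mem_cell_of_not_isBoundary heK he
  have hr : cross (q - p) (r - p) ≠ 0 := by
    apply cross_ne_zero_of_interior_nonempty
    simpa [Element.cell, Element.closedCell, hK] using Element.cell_nonempty K
  set κ := cross (q - p) (r - p) with hκ
  have hz0 : cross (q - p) (z - p) = 0 := by
    have h := hze.1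
    rw [Edge.closedCell, hpe, Finset.coe_insert, Finset.coe_singleton, convexHull_pair] at h
    obtain ⟨a, b, -, -, hab, rfl⟩ := h
    obtain rfl : a = 1 - b := by linarith
    simp [cross]; ring
  -- A finite union of closed triangles missing `z`, hence avoided by points close to `z`.
  let C : Set Plane := ⋃ K' ∈ {K' : T.Element | z ∉ K'.closedCell}, K'.closedCell
  have hC : IsClosed C := (toFinite _).isClosed_biUnion fun K' _ => (Element.isCompact K').isClosed
  have hzC : z ∉ C := by
    simp only [C, mem_iUnion, not_exists]
    exact fun K' h => h
  have hlim : Filter.Tendsto (fun t : ℝ => z + t • (z - r)) (nhdsWithin 0 (Ioi 0)) (nhds z) := by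
    have : Continuous (fun t : ℝ => z + t • (z - r)) := by fun_prop
    simpa using (this.tendsto 0).mono_left nhdsWithin_le_nhds
  obtain ⟨t, ⟨htΩ, htC⟩, ht0⟩ := (((hlim.eventually ((isOpen_domain T).mem_nhds hzΩ)).and
    (hlim.eventually (hC.isOpen_compl.mem_nhds hzC))).and self_mem_nhdsWithin).exists
  have ht0' : 0 < t := ht0
  obtain ⟨K', hK'⟩ := exists_element_of_mem (T := T) htΩ
  have hzK' : z ∈ K'.closedCell := by
    by_contra h
    exact htC (mem_biUnion (show K' ∈ {K' : T.Element | z ∉ K'.closedCell} from h) hK')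
  obtain ⟨s, hs1, hs2, hs3⟩ := mem_convexHull_inter e.2.1 K'.2.1 hze.1 hzK'
  have hsub : e.1 ⊆ K'.1 := (Edge.subset_of_mem_convexHull hze hs1 hs3).trans hs2
  classical
  obtain ⟨r', hr'⟩ : ∃ r', K'.1 \ e.1 = {r'} := by
    rw [← Finset.card_eq_one, Finset.card_sdiff_of_subset hsub, K'.2.2, e.2.2]
  have hK'eq : K'.1 = {p, q, r'} := by
    rw [← Finset.union_sdiff_of_subset hsub, hr', hpe]
    ext x; simp
  refine ⟨K', r', hK'eq, ?_⟩
  by_contra! hge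
  have h0 : κ * cross (q - p) (p - p) = 0 := by simp [cross]
  have h1 : κ * cross (q - p) (q - p) = 0 := by simp [cross]; right; ring
  have h2 := convexHull_subset_cross_nonneg h0.ge h1.ge hge
  have h3 : z + t • (z - r) ∈ convexHull ℝ {p, q, r'} := by
    simpa [Element.closedCell, hK'eq] using hK'
  have h4 : 0 ≤ κ * cross (q - p) (z + t • (z - r) - p) := h2 h3
  have h5 : cross (q - p) (z + t • (z - r) - p) =
      (1 + t) * cross (q - p) (z - p) - t * κ := by
    rw [hκ]; simp [cross]; ring
  rw [h5, hz0] at h4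
  have : 0 < t * κ ^ 2 := by positivity
  nlinarith

/-! ### Edge functions that are constant on each element -/

lemma exists_eq_triple {s : Finset Plane} (hs : s.card = 3) {p q : Plane} (hp : p ∈ s) (hq : q ∈ s)
    (hpq : p ≠ q) : ∃ r, s = {p, q, r} := by
  classical
  have hsub : ({p, q} : Finset Plane) ⊆ s := by
    intro x hx
    simp only [Finset.mem_insert, Finset.mem_singleton] at hx
    rcases hx with rfl | rfl <;> assumption
  obtain ⟨r, hr⟩ : ∃ r, s \ {p, q} = {r} := by
    rw [← Finset.card_eq_one, Finset.card_sdiff_of_subset hsub, hs, Finset.card_pair hpq]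
  refine ⟨r, ?_⟩
  rw [← Finset.union_sdiff_of_subset hsub, hr]
  ext x; simp

lemma Element.mem_edges {K : T.Element} {e : T.Edge} : e ∈ K.edges ↔ e.1 ⊆ K.1 := by
  simp [Element.edges]

/-- If `w` takes a value `m ≠ 0`, the elements on which `w = m` form a set `S` closed under passing
to neighbours, because no edge with value `m` is a boundary edge. Being finite, `S` has an extreme
vertex and an extreme edge there, beyond which it has no element. Connectedness of the domain plays
no role. -/
theorem eq_zero_of_constant_on_elements {w : T.Edge → ℝ}
    (hconst : ∀ K : T.Element, ∀ e ∈ K.edges, ∀ e' ∈ K.edges, w e = w e')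
    (hbd : ∀ e : T.Edge, e.IsBoundary → w e = 0) (e₀ : T.Edge) : w e₀ = 0 := by
  by_contra hm
  obtain ⟨K₀, hK₀, hcard, hsub⟩ := T.pure e₀.1 e₀.2.1
  set m := w e₀ with hm'
  let S : Set T.Element := {K | ∀ e ∈ K.edges, w e = m}
  have hS₀ : (⟨K₀, hK₀, hcard⟩ : T.Element) ∈ S := fun e he =>
    hconst _ e he e₀ (Element.mem_edges.2 hsub)
  let V : Set Plane := ⋃ K ∈ S, (K.1 : Set Plane)
  have hVfin : V.Finite := (toFinite S).biUnion fun K _ => K.1.finite_toSet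
  have hVmem : ∀ {K : T.Element} {x : Plane}, K ∈ S → x ∈ K.1 → x ∈ V :=
    fun hK hx => mem_biUnion hK hx
  -- With `p` farthest from the origin, all other vertices of `S` lie strictly on one side of the
  -- line through `p` orthogonal to `p`.
  obtain ⟨p, hpV, hpmax⟩ := exists_max_image V (fun x => ‖x‖) hVfin (by
    obtain ⟨x, hx⟩ := Finset.card_pos.1 (by omega : 0 < K₀.card)
    exact ⟨x, hVmem hS₀ hx⟩)
  let Q : Set Plane := {q | q ≠ p ∧ ∃ K ∈ S, p ∈ K.1 ∧ q ∈ K.1}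
  have hQV : Q ⊆ V := fun q ⟨_, K, hK, _, hq⟩ => hVmem hK hq
  -- The ratio is, up to sign, the tangent of the angle between `-p` and `q - p`. Its maximum
  -- selects an extreme direction among the edges at `p`.
  obtain ⟨q, ⟨hqp, K, hKS, hpK, hqK⟩, hqmax⟩ := exists_max_image Q
    (fun q => cross p (q - p) / inner ℝ p (p - q)) (hVfin.subset hQV) (by
      obtain ⟨K, hK, hpK⟩ := mem_iUnion₂.1 hpV
      obtain ⟨q, hq, hqp⟩ := Finset.exists_mem_ne (by rw [K.2.2]; norm_num : 1 < K.1.card) p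
      exact ⟨q, hqp, K, hK, hpK, hq⟩)
  have hpos : ∀ x ∈ Q, 0 < inner ℝ p (p - x) := by
    intro x hx
    have h1 := hpmax x (hQV hx)
    have h2 : 0 < ‖p - x‖ ^ 2 := by
      have := sub_ne_zero.2 hx.1.symm
      positivity
    have h3 : ‖x‖ ^ 2 ≤ ‖p‖ ^ 2 := by gcongr
    rw [norm_sub_sq_real] at h2
    rw [inner_sub_right, real_inner_self_eq_norm_sq]
    linarith
  have hqQ : q ∈ Q := ⟨hqp, K, hKS, hpK, hqK⟩
  have hside : ∀ x ∈ Q, 0 ≤ cross (q - p) (x - p) := by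
    intro x hx
    have h1 := hqmax x hx
    rw [div_le_div_iff₀ (hpos x hx) (hpos q hqQ)] at h1
    have h2 : cross (q - p) (x - p) * ‖p‖ ^ 2 =
        cross p (q - p) * inner ℝ p (p - x) - cross p (x - p) * inner ℝ p (p - q) := by
      rw [norm_sq_plane, inner_plane, inner_plane]
      simp [cross]; ring
    have h3 : 0 < ‖p‖ ^ 2 := by
      have : p ≠ 0 := by
        rintro rfl
        have := hpos q hqQ
        simp at this
      positivity
    refine nonneg_of_mul_nonneg_left ?_ h3
    rw [h2]; linarith
  obtain ⟨r, hr⟩ := exists_eq_triple K.2.2 hpK hqK hqp.symm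
  let e : T.Edge := ⟨{p, q}, T.complex.down_closed K.2.1 (by
    rw [hr]; intro x; simp; tauto) (by simp), Finset.card_pair hqp.symm⟩
  have hwe : w e = m := hKS e (Element.mem_edges.2 (by
    rw [hr]; intro x; simp [e]; tauto))
  obtain ⟨K', r', hK', hneg⟩ := exists_neighbor (e := e) hr rfl (fun hb => hm (hwe ▸ hbd e hb))
  have hK'S : K' ∈ S := fun e' he' => by
    rw [← hwe]
    refine hconst K' e' he' e (Element.mem_edges.2 ?_)
    rw [hK']; intro x; simp [e]; tauto
  have hne : ∀ {K : T.Element} {x : Plane}, K.1 = {p, q, x} → x ≠ p := by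
    rintro K x h rfl
    have h1 := K.2.2
    rw [h] at h1
    have : ({x, q, x} : Finset Plane).card ≤ 2 := by
      rw [Finset.insert_eq_of_mem (by simp)]
      exact Finset.card_le_two
    omega
  -- Both `r` and `r'` are on the same side of the line `pq`, although neighbours across it lie on
  -- opposite sides.
  have h1 := hside r ⟨hne hr, K, hKS, hpK, by simp [hr]⟩
  have h2 := hside r' ⟨hne hK', K', hK'S, by simp [hK'], by simp [hK']⟩
  nlinarith [mul_nonneg h1 h2]

/-- The uniform constant `c` bounds all the smallest eigenvalues below, so the infimum is a genuine
one, positive, and itself an ellipticity constant. -/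
theorem isDiffusion_lambdaMin {A : Plane → Matrix (Fin 2) (Fin 2) ℝ}
    (hsymm : ∀ x ∈ Ω, (A x).IsSymm) {c : ℝ} (hc : 0 < c) (hpos : ∀ x ∈ Ω, IsElliptic c (A x))
    {K : T.Element} {L : ℝ} (hLip : ∀ x ∈ K.cell, ∀ y ∈ K.cell, ‖A x - A y‖ ≤ L * ‖x - y‖) :
    IsDiffusion A K (lambdaMin A K) L := by
  have hsub := Element.cell_subset K
  have hle : ∀ x : K.cell, c ≤ sInf (spectrum ℝ (A x)) := fun x =>
    le_csInf (spectrum_real_nonempty (hsymm x (hsub x.2))) fun μ hμ =>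
      le_of_mem_spectrum (hpos x (hsub x.2)) hμ
  have : Nonempty K.cell := (Element.cell_nonempty K).to_subtype
  refine ⟨fun x hx => hsymm x (hsub hx), hc.trans_le (le_ciInf hle), fun x hx ξ => ?_, hLip⟩
  refine sInf_spectrum_mul_norm_sq_le (hsymm x (hsub hx)) ?_ ξ
  exact ciInf_le (f := fun x : K.cell => sInf (spectrum ℝ (A x)))
    ⟨c, by rintro _ ⟨y, rfl⟩; exact hle y⟩ ⟨x, hx⟩

/-! ### Elimination of the element value on one element -/

namespace Labelling

variable {K : T.Element} (l : Labelling K) {A : Plane → Matrix (Fin 2) (Fin 2) ℝ} {c L : ℝ}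

/-- The coefficient of the value on the edge `i` in the elimination of the element value. -/
def weight (A : Plane → Matrix (Fin 2) (Fin 2) ℝ) (i : Fin 3) : ℝ :=
  1 / 3 + 2 * l.inertia * inner ℝ (l.normal i) (l.moment A) / (l.det ^ 2 * l.energy A)

lemma inner_grad (v : DiscreteFunction T) (w : Plane) :
    inner ℝ (l.grad v) w = 2 / l.det * ∑ i, v.edge (l.edge i) * inner ℝ (l.normal i) w := by
  rw [grad, real_inner_smul_left, sum_inner]
  simp only [real_inner_smul_left]

lemma sum_weight : ∑ i, l.weight A i = 1 := by
  have h : ∑ i, inner ℝ (l.normal i) (l.moment A) = 0 := by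
    rw [← sum_inner, l.sum_normal, inner_zero_left]
  simp only [weight, Fin.sum_univ_three] at h ⊢
  linear_combination 2 * l.inertia / (l.det ^ 2 * l.energy A) * h

lemma sum_weight_mul (v : DiscreteFunction T) (hD : l.energy A ≠ 0) :
    ∑ i, v.edge (l.edge i) * l.weight A i =
      l.edgeMean v + l.inertia / (l.det * l.energy A) * inner ℝ (l.grad v) (l.moment A) := by
  have hδ := l.det_pos.ne'
  rw [inner_grad, edgeMean]
  simp only [weight, Fin.sum_univ_three]
  field_simp
  ring

lemma integral_matForm_weakGradient (h : IsDiffusion A K c L) (v u : DiscreteFunction T) :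
    ∫ x in K.cell, matForm (A x) (weakGradient v K x) (weakGradient u K x) =
      K.area * matForm (average A K) (l.grad v) (l.grad u) +
        l.slope u * inner ℝ (l.grad v) (l.moment A) +
        l.slope v * inner ℝ (l.grad u) (l.moment A) + l.slope v * l.slope u * l.energy A := by
  rw [l.weakGradient_eq v, l.weakGradient_eq u, ← l.integral_matForm_affine h]

/-- The three normals satisfy, up to a factor, only the one linear relation that their sum is zero.
-/
lemma edge_eq_of_grad_eq_zero {v : DiscreteFunction T} (h : l.grad v = 0) (i j : Fin 3) :
    v.edge (l.edge i) = v.edge (l.edge j) := by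
  have hδ := l.det_pos
  rw [grad, smul_eq_zero_iff_right (by positivity)] at h
  have h0 := congrArg (fun x : Plane => x 0) h
  have h1 := congrArg (fun x : Plane => x 1) h
  simp [Fin.sum_univ_three, normal, rot, tangent] at h0 h1
  have hdef : l.det = (l.vertex 1 0 - l.vertex 0 0) * (l.vertex 2 1 - l.vertex 0 1) -
    (l.vertex 1 1 - l.vertex 0 1) * (l.vertex 2 0 - l.vertex 0 0) := by
    simp [det, cross]
  have e1 : v.edge (l.edge 0) = v.edge (l.edge 2) := by
    refine mul_left_cancel₀ hδ.ne' ?_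
    rw [hdef]
    linear_combination (l.vertex 2 0 - l.vertex 0 0) * h0 + (l.vertex 2 1 - l.vertex 0 1) * h1
  have e2 : v.edge (l.edge 1) = v.edge (l.edge 2) := by
    refine mul_left_cancel₀ hδ.ne' ?_
    rw [hdef]
    linear_combination (l.vertex 2 0 - l.vertex 1 0) * h0 + (l.vertex 2 1 - l.vertex 1 1) * h1
  fin_cases i <;> fin_cases j <;> simp [e1, e2]

/-- On edges `u - M = v - n` with `v`, `n` the positive and negative parts, and constants have zero
`grad`. In the cross term of `v` and `n` the diagonal vanishes since `v_i n_i = 0`, and the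
remaining entries have the favourable sign. -/
lemma matForm_schur_posPart (h : IsDiffusion A K c L)
    (hangle : ∀ i j, i ≠ j → matForm (l.schur A) (l.normal i) (l.normal j) ≤ 0)
    {u v : DiscreteFunction T} {M : ℝ} (hv : ∀ e, v.edge e = max (u.edge e - M) 0) :
    c * K.area * ‖l.grad v‖ ^ 2 ≤ matForm (l.schur A) (l.grad v) (l.grad u) := by
  refine (l.schur_coercive h _).trans ?_
  set n : Fin 3 → ℝ := fun i => max (M - u.edge (l.edge i)) 0 with hn
  have hu : l.grad u = l.grad v + (-(2 / l.det)) • ∑ i, n i • l.normal i := by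
    have e : ∀ i, u.edge (l.edge i) • l.normal i =
        v.edge (l.edge i) • l.normal i - n i • l.normal i + M • l.normal i := by
      intro i
      rw [← sub_smul, ← add_smul]
      congr 1
      rw [hv, hn]
      simp only
      rcases le_total (u.edge (l.edge i)) M with h | h
      · rw [max_eq_right (by linarith), max_eq_left (by linarith)]; ring
      · rw [max_eq_left (by linarith), max_eq_right (by linarith)]; ring
    rw [grad, grad]
    simp only [e]
    rw [Finset.sum_add_distrib, Finset.sum_sub_distrib, ← Finset.smul_sum, l.sum_normal]
    module
  rw [hu, matForm_add_right, matForm_smul_right]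
  have hterm : ∀ i j, v.edge (l.edge i) * n j * matForm (l.schur A) (l.normal i) (l.normal j) ≤ 0 := by
    intro i j
    have h1 : 0 ≤ v.edge (l.edge i) := by rw [hv]; exact le_max_right _ _
    have h2 : 0 ≤ n j := le_max_right _ _
    by_cases hij : i = j
    · subst hij
      have : v.edge (l.edge i) * n i = 0 := by
        rw [hv, hn]
        simp only
        rcases le_total (u.edge (l.edge i)) M with h | h
        · rw [max_eq_right (by linarith), zero_mul]
        · rw [max_eq_right (a := M - _) (by linarith), mul_zero]
      rw [this, zero_mul]
    · exact mul_nonpos_of_nonneg_of_nonpos (mul_nonneg h1 h2) (hangle i j hij)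
  have hsum : matForm (l.schur A) (l.grad v) (∑ i, n i • l.normal i) ≤ 0 := by
    have hδ := l.det_pos
    rw [grad, matForm_smul_left]
    refine mul_nonpos_of_nonneg_of_nonpos (by positivity) ?_
    simp only [Fin.sum_univ_three, matForm_add_left, matForm_add_right, matForm_smul_left,
      matForm_smul_right]
    linarith [hterm 0 0, hterm 0 1, hterm 0 2, hterm 1 0, hterm 1 1, hterm 1 2, hterm 2 0,
      hterm 2 1, hterm 2 2]
  have hδ := l.det_pos
  have h1 : 0 ≤ -(2 / l.det) * matForm (l.schur A) (l.grad v) (∑ i, n i • l.normal i) :=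
    mul_nonneg_of_nonpos_of_nonpos (by simp; positivity) hsum
  linarith

end Labelling

/-! ### The condensed system and the maximum principle -/

namespace IsWeakGalerkinSolution

variable {A : Plane → Matrix (Fin 2) (Fin 2) ℝ} {f : Plane → ℝ}
  {g : {e : T.Edge // e.IsBoundary} → ℝ} {u : DiscreteFunction T} {c L : T.Element → ℝ}

lemma element_equation (hu : IsWeakGalerkinSolution T A f g u)
    (hA : ∀ K, IsDiffusion A K (c K) (L K)) {K : T.Element} (l : Labelling K) :
    l.slope u * l.energy A =
      -inner ℝ (l.grad u) (l.moment A) - l.inertia / l.det * ∫ x in K.cell, f x := by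
  classical
  -- The indicator of the interior of `K`: its weak gradient vanishes on the other elements and has
  -- no constant part on `K`.
  let v : DiscreteFunction T := ⟨Pi.single K 1, 0⟩
  have hgrad : ∀ {K' : T.Element} (l' : Labelling K'), l'.grad v = 0 := fun l' => by
    simp [Labelling.grad, v]
  have h := hu.2 v fun e _ => rfl
  rw [Finset.sum_eq_single K, Finset.sum_eq_single K, l.integral_matForm_weakGradient (hA K)] at h
  · have hs : l.slope v = -l.det / l.inertia := by
      simp [Labelling.slope, Labelling.edgeMean, v]
    have hI := l.inertia_pos
    have hδ := l.det_pos
    rw [hgrad, hs] at h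
    simp [matForm_eq, v] at h
    rw [← h]
    field_simp
    ring
  · intro K' _ hne
    simp [v, hne]
  · simp
  · intro K' _ hne
    obtain ⟨l'⟩ := exists_labelling K'
    rw [l'.integral_matForm_weakGradient (hA K')]
    have hs : l'.slope v = 0 := by
      simp [Labelling.slope, Labelling.edgeMean, v, hne]
    rw [hgrad, hs]
    simp [matForm_eq]
  · simp

lemma elem_eq (hu : IsWeakGalerkinSolution T A f g u)
    (hA : ∀ K, IsDiffusion A K (c K) (L K)) {K : T.Element} (l : Labelling K) :
    u.elem K = ∑ i, u.edge (l.edge i) * l.weight A i +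
      l.inertia ^ 2 / (l.det ^ 2 * l.energy A) * ∫ x in K.cell, f x := by
  have hD := l.energy_pos (hA K)
  have hI := l.inertia_pos
  have hδ := l.det_pos
  have h := hu.element_equation hA l
  rw [l.sum_weight_mul u hD.ne']
  rw [Labelling.slope] at h
  field_simp at h ⊢
  linear_combination -h

lemma sum_schur_eq (hu : IsWeakGalerkinSolution T A f g u)
    (hA : ∀ K, IsDiffusion A K (c K) (L K)) (l : ∀ K : T.Element, Labelling K)
    (v : DiscreteFunction T) (hv : ∀ e : T.Edge, e.IsBoundary → v.edge e = 0) :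
    ∑ K, matForm ((l K).schur A) ((l K).grad v) ((l K).grad u) =
      ∑ K, (∑ i, v.edge ((l K).edge i) * (l K).weight A i) * ∫ x in K.cell, f x := by
  -- Only the edge values of `v` matter here. Taking the mean as element value makes the slope zero;
  -- inserting the formula for `slope u` then produces the Schur form and moves the `f` term into
  -- the weights.
  let v' : DiscreteFunction T := ⟨fun K => (l K).edgeMean v, v.edge⟩
  have h := hu.2 v' hv
  rw [← sub_eq_zero, ← Finset.sum_sub_distrib] at h ⊢
  rw [← h]
  refine Finset.sum_congr rfl fun K _ => ?_
  have hs : (l K).slope v' = 0 := by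
    simp [Labelling.slope, v', Labelling.edgeMean]
  have hg : (l K).grad v' = (l K).grad v := rfl
  have hD := (l K).energy_pos (hA K)
  have hδ := (l K).det_pos
  have h1 := hu.element_equation hA (l K)
  have h2 : (l K).slope u = (-inner ℝ ((l K).grad u) ((l K).moment A) -
      (l K).inertia / (l K).det * ∫ x in K.cell, f x) / (l K).energy A := by
    rw [← h1]; field_simp
  rw [(l K).integral_matForm_weakGradient (hA K), hs, hg, Labelling.matForm_schur,
    (l K).sum_weight_mul v hD.ne', integral_mul_const, h2]
  simp only [v']
  field_simp
  ring

theorem edge_le (hu : IsWeakGalerkinSolution T A f g u)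
    (hA : ∀ K, IsDiffusion A K (c K) (L K)) (l : ∀ K : T.Element, Labelling K)
    (hangle : ∀ K i j, i ≠ j →
      matForm ((l K).schur A) ((l K).normal i) ((l K).normal j) ≤ 0)
    (hweight : ∀ K i, 0 ≤ (l K).weight A i) (hf : ∀ x ∈ Ω, f x ≤ 0) {M : ℝ}
    (hM : ∀ e : T.Edge, e.IsBoundary → u.edge e ≤ M) (e : T.Edge) : u.edge e ≤ M := by
  -- The positive part of `u_b - M`, admissible since it vanishes on the boundary edges.
  let v : DiscreteFunction T := ⟨0, fun e => max (u.edge e - M) 0⟩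
  have hvb : ∀ e : T.Edge, e.IsBoundary → v.edge e = 0 := fun e he =>
    max_eq_right (by linarith [hM e he])
  have hF : ∀ K : T.Element, ∫ x in K.cell, f x ≤ 0 := fun K =>
    setIntegral_nonpos isOpen_interior.measurableSet fun x hx => hf x (Element.cell_subset K hx)
  have hle : ∑ K, c K * K.area * ‖(l K).grad v‖ ^ 2 ≤ 0 := by
    calc _ ≤ ∑ K, matForm ((l K).schur A) ((l K).grad v) ((l K).grad u) :=
          Finset.sum_le_sum fun K _ =>
            (l K).matForm_schur_posPart (hA K) (hangle K) (M := M) fun e => rfl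
      _ = _ := hu.sum_schur_eq hA l v hvb
      _ ≤ 0 := Finset.sum_nonpos fun K _ => mul_nonpos_of_nonneg_of_nonpos
          (Finset.sum_nonneg fun i _ => mul_nonneg (le_max_right _ _) (hweight K i)) (hF K)
  have hpos : ∀ K : T.Element, 0 < c K * K.area := fun K => mul_pos (hA K).pos (Element.area_pos K)
  have hzero := (Finset.sum_eq_zero_iff_of_nonneg fun K _ =>
    mul_nonneg (hpos K).le (sq_nonneg ‖(l K).grad v‖)).1
      (hle.antisymm (Finset.sum_nonneg fun K _ => mul_nonneg (hpos K).le (sq_nonneg _)))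
  have hgrad : ∀ K, (l K).grad v = 0 := fun K => by
    have := (mul_eq_zero.1 (hzero K (Finset.mem_univ K))).resolve_left (hpos K).ne'
    simpa using this
  have hv := eq_zero_of_constant_on_elements (w := v.edge) (fun K e he e' he' => by
    classical
    rw [(l K).edges_eq, Finset.mem_image] at he he'
    obtain ⟨i, -, rfl⟩ := he
    obtain ⟨j, -, rfl⟩ := he'
    exact (l K).edge_eq_of_grad_eq_zero (hgrad K) i j) hvb e
  linarith [max_eq_right_iff.1 hv]

theorem elem_le (hu : IsWeakGalerkinSolution T A f g u)
    (hA : ∀ K, IsDiffusion A K (c K) (L K)) {K : T.Element} (l : Labelling K)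
    (hweight : ∀ i, 0 ≤ l.weight A i) (hf : ∀ x ∈ Ω, f x ≤ 0) {M : ℝ}
    (hM : ∀ e : T.Edge, u.edge e ≤ M) : u.elem K ≤ M := by
  have hF : ∫ x in K.cell, f x ≤ 0 :=
    setIntegral_nonpos isOpen_interior.measurableSet fun x hx => hf x (Element.cell_subset K hx)
  have hD := l.energy_pos (hA K)
  rw [hu.elem_eq hA l]
  have h1 : ∑ i, u.edge (l.edge i) * l.weight A i ≤ ∑ i, M * l.weight A i :=
    Finset.sum_le_sum fun i _ => mul_le_mul_of_nonneg_right (hM _) (hweight i)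
  rw [← Finset.mul_sum, l.sum_weight, mul_one] at h1
  have h2 : l.inertia ^ 2 / (l.det ^ 2 * l.energy A) * ∫ x in K.cell, f x ≤ 0 :=
    mul_nonpos_of_nonneg_of_nonpos (by positivity) hF
  linarith

end IsWeakGalerkinSolution

end WeakGalerkin

end

theorem mainTheorem4 (Ω : Set WeakGalerkin.Plane) (T : WeakGalerkin.TriangularMesh Ω)
    (A : WeakGalerkin.Plane → Matrix (Fin 2) (Fin 2) ℝ)
    (hAsymm : ∀ x ∈ Ω, (A x).IsSymm)
    (hApos : ∃ c : ℝ, 0 < c ∧ ∀ x ∈ Ω, ∀ ξ : WeakGalerkin.Plane,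
      c * ‖ξ‖ ^ 2 ≤ WeakGalerkin.matForm (A x) ξ ξ)
    (L : T.Element → ℝ)
    -- here the matrix norm is the operator norm induced by the Euclidean norm
    (hLip : ∀ K : T.Element, ∀ x ∈ K.cell, ∀ y ∈ K.cell, ‖A x - A y‖ ≤ L K * ‖x - y‖)
    (hangle : ∀ K : T.Element, ∀ p ∈ K.1, ∀ q ∈ K.1, ∀ r ∈ K.1, p ≠ q → p ≠ r → q ≠ r →
      L K ^ 2 * K.diam ^ 2 / WeakGalerkin.lambdaMin A K ^ 2 ≤
        WeakGalerkin.cosAngle (WeakGalerkin.average A K)⁻¹ p q r)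
    -- for `L K = 0` the right-hand side is `∞`, and the condition is void
    (hshape : ∀ K : T.Element, 0 < L K →
      K.diam ^ 3 / K.area ≤ 2 * WeakGalerkin.lambdaMin A K / (3 * L K))
    (f : WeakGalerkin.Plane → ℝ) (hf : IntegrableOn f Ω)
    (g : {e : T.Edge // e.IsBoundary} → ℝ) (u : WeakGalerkin.DiscreteFunction T)
    (hu : WeakGalerkin.IsWeakGalerkinSolution T A f g u) :
    (∀ x ∈ Ω, f x ≤ 0) →
      ∀ x ∈ Ω, x ∉ T.complex.vertices →
        u.toFun x ≤ max 0 (⨆ e : {e : T.Edge // e.IsBoundary}, u.edge e.1) := by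
  intro hf0 x _ _
  obtain ⟨c, hc, hpos⟩ := hApos
  have hA : ∀ K, WeakGalerkin.IsDiffusion A K (WeakGalerkin.lambdaMin A K) (L K) := fun K =>
    WeakGalerkin.isDiffusion_lambdaMin hAsymm hc hpos (hLip K)
  have l : ∀ K : T.Element, WeakGalerkin.Labelling K := fun K =>
    (WeakGalerkin.exists_labelling K).some
  have hweight : ∀ K i, 0 ≤ (l K).weight A i := fun K i =>
    (l K).weight_nonneg (hA K) (hshape K) i
  have hbd : ∀ e : T.Edge, e.IsBoundary →
      u.edge e ≤ max 0 (⨆ e : {e : T.Edge // e.IsBoundary}, u.edge e.1) := fun e he =>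
    (le_ciSup (f := fun e : {e : T.Edge // e.IsBoundary} => u.edge e.1)
      (finite_range _).bddAbove ⟨e, he⟩).trans (le_max_right _ _)
  have hedge := hu.edge_le hA l
    (fun K i j hij => (l K).schur_normal_nonpos (hA K) (hangle K) hij) hweight hf0 hbd
  exact u.toFun_le (le_max_left _ _)
    (fun K => hu.elem_le hA (l K) (hweight K) hf0 hedge) hedge x
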